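/- **Theorem 4.1.** Let $a=\tfrac32$, $g(k)=\sqrt{k}\,(k^2+a^2)^{-2}$ and $G(k)=g(k)^2$ for $k>0$, and let $$F(\lambda)=\mathrm{vp}\!\int_0^\infty \frac{G(k)}{k-\lambda}\,dk ,\qquad \lambda>0,$$ be the Cauchy principal value (which exists for all $\lambda>0$). Let $E_0>0$. For $\beta>0$ let $H$ be the Friedrichs Hamiltonian $$H(z,\psi)=\bigl(E_0z+\beta\langle g,\psi\rangle,\ \beta z\,g+k\,\psi\bigr)$$ on $\mathbb C\oplus L^2((0,\infty),dk)$, with domain $\{(z,\psi): k\psi\in L^2\}$. Put $\Phi_1=(1,0)$ (the Weisskopf–Wigner state) and $R(t)=(\Phi_1,e^{-iHt}\Phi_1)$, where $e^{-iHt}$ is the strongly continuous unitary group with generator $-iH$ (which exists). There are constants $b>0$, $0<r<E_0$, $C>0$, $d>0$ and $c>0$, depending only on $E_0$, such that for every $0<\beta<b$ the following holds. The equation $$E_0-\lambda_0-\beta^2F(\lambda_0)=0$$ has exactly one solution $\lambda_0$ with $|\lambda_0-E_0|<r$. With this $\lambda_0$ and $\Gamma=2\pi\beta^2G(E_0)$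 there are a complex number $K$ with $|K|\le C\beta^2$ and functions $c_0,c_1,c_2$ with $$R(t)=(1+K)\,e^{-i\lambda_0t}\,e^{-\Gamma t/2}+c_0(t),\qquad c_0(t)=c_1(t)+c_2(t)\qquad\text{for all } t\ge0,$$ $$\lim_{t\to\infty}t\,c_1(t)=\frac{\beta^2d}{E_0},\qquad |c_2(t)|\le\frac{c\,\beta^2}{t}\quad\text{for all } t>0 .$$ -/

import Mathlib

open MeasureTheory Set Filter Topology

namespace Friedrichs

noncomputable section

/-! ### Unitary groups -/

/-- `U` is the unitary group `t ↦ exp (-i t A)`: a strongly continuous one-parameter group of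
unitary operators whose infinitesimal generator is exactly `-i A`, domain included.  (By Stone's
theorem a self-adjoint `A` has exactly one such group.) -/
structure IsUnitaryGroup {E : Type*} [NormedAddCommGroup E] [InnerProductSpace ℂ E]
    [CompleteSpace E] (A : E →ₗ.[ℂ] E) (U : ℝ → E →L[ℂ] E) : Prop where
  zero : U 0 = 1
  add : ∀ s t, U (s + t) = U s * U t
  unitary : ∀ t, U t ∈ unitary (E →L[ℂ] E)
  continuous : ∀ x, Continuous fun t => U t x
  generator : ∀ x y, (x, y) ∈ A.graph ↔ HasDerivAt (fun t => U t x) (-(Complex.I • y)) 0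

/-- The unitary group `t ↦ exp (-i t A)` of an operator `A`.  It is meaningful only if `A`
generates a unitary group, that is, if `IsUnitaryGroup A (unitaryGroup A)` holds. -/
def unitaryGroup {E : Type*} [NormedAddCommGroup E] [InnerProductSpace ℂ E]
    [CompleteSpace E] (A : E →ₗ.[ℂ] E) : ℝ → E →L[ℂ] E :=
  Classical.epsilon (IsUnitaryGroup A)

/-! ### The form factor -/

/-- The inverse length `a = 3/2` (in Bohr units). -/
def a : ℝ := 3 / 2

/-- The form factor `g(k) = √k (k² + a²)⁻²`. -/
def g (k : ℝ) : ℝ := √k * ((k ^ 2 + a ^ 2) ^ 2)⁻¹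

/-- `G = g²`. -/
def G (k : ℝ) : ℝ := g k ^ 2

/-- The integral of `G(k) / (k - x)` over `(0, ∞)` with the interval `[x - ε, x + ε]` removed. -/
def truncatedIntegral (x ε : ℝ) : ℝ :=
  ∫ k in {k : ℝ | 0 < k ∧ ε < |k - x|}, G k / (k - x)

/-- `F(x)`, the Cauchy principal value of the integral of `G(k) / (k - x)` over `(0, ∞)`. -/
def F (x : ℝ) : ℝ := limUnder (𝓝[>] 0) (truncatedIntegral x)

/-- The half-width `Γ = 2 π β² G(E₀)`. -/
def halfWidth (E₀ β : ℝ) : ℝ := 2 * Real.pi * β ^ 2 * G E₀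

/-! ### The one-excitation Hamiltonian -/

/-- The photon energies: the half-line `(0, ∞)` with Lebesgue measure. -/
abbrev energyMeasure : Measure ℝ := volume.restrict (Ioi 0)

/-- The one-photon space `L²(0, ∞)`. -/
abbrev Photon : Type := Lp ℂ 2 energyMeasure

/-- The one-excitation space `ℂ ⊕ L²(0, ∞)`, a Hilbert space with the direct-sum inner product. -/
abbrev Space : Type := WithLp 2 (ℂ × Photon)

lemma a_sq : a ^ 2 = 9 / 4 := by norm_num [a]

lemma memLp_g : MemLp (fun k => (g k : ℂ)) 2 energyMeasure := by
  have hm : Measurable fun k : ℝ => (g k : ℂ) := by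
    unfold g
    fun_prop
  rw [memLp_two_iff_integrable_sq_norm hm.aestronglyMeasurable]
  refine Integrable.mono' (integrable_inv_one_add_sq.restrict (s := Ioi 0))
    (hm.norm.pow_const 2).aestronglyMeasurable ?_
  filter_upwards [ae_restrict_mem measurableSet_Ioi] with k hk
  have hk : (0 : ℝ) < k := hk
  have h1 : ‖(g k : ℂ)‖ ^ 2 = k * ((k ^ 2 + 9 / 4) ^ 4)⁻¹ := by
    rw [Complex.norm_real, Real.norm_eq_abs, sq_abs, g, mul_pow, Real.sq_sqrt hk.le, a_sq,
      inv_pow, ← pow_mul]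
  rw [h1, Real.norm_of_nonneg (by positivity), ← div_eq_mul_inv, ← one_div,
    div_le_div_iff₀ (by positivity) (by positivity), one_mul]
  have h2 : k ≤ k ^ 2 + 9 / 4 := by nlinarith [sq_nonneg (k - 1)]
  have h3 : 1 + k ^ 2 ≤ k ^ 2 + 9 / 4 := by linarith
  have h4 : (1 : ℝ) ≤ (k ^ 2 + 9 / 4) ^ 2 := one_le_pow₀ (by nlinarith [sq_nonneg k])
  calc k * (1 + k ^ 2) ≤ (k ^ 2 + 9 / 4) * (k ^ 2 + 9 / 4) := by gcongr
    _ = (k ^ 2 + 9 / 4) ^ 2 * 1 := by ring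
    _ ≤ (k ^ 2 + 9 / 4) ^ 2 * (k ^ 2 + 9 / 4) ^ 2 := by gcongr
    _ = (k ^ 2 + 9 / 4) ^ 4 := by ring

/-- The form factor as a vector of `L²(0, ∞)`. -/
def gVec : Photon := memLp_g.toLp _

/-- The vectors `(z, ψ)` of the Hilbert space such that `k ψ(k)` is again square-integrable. -/
def hamiltonianDomain : Submodule ℂ Space where
  carrier := {x | MemLp (fun k : ℝ => (k : ℂ) * x.snd k) 2 energyMeasure}
  zero_mem' := by
    refine (memLp_congr_ae ?_).2 (MemLp.zero (ε := ℂ))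
    filter_upwards [Lp.coeFn_zero ℂ 2 energyMeasure] with k hk
    rw [WithLp.zero_snd, hk, Pi.zero_apply, mul_zero]
  add_mem' := by
    intro x y hx hy
    refine (memLp_congr_ae ?_).2 (MemLp.add hx hy)
    filter_upwards [Lp.coeFn_add x.snd y.snd] with k hk
    rw [WithLp.add_snd, hk, Pi.add_apply, Pi.add_apply, mul_add]
  smul_mem' := by
    intro c x hx
    refine (memLp_congr_ae ?_).2 (MemLp.const_smul hx c)
    filter_upwards [Lp.coeFn_smul c x.snd] with k hk
    rw [WithLp.smul_snd, hk, Pi.smul_apply, Pi.smul_apply, smul_eq_mul, smul_eq_mul,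
      mul_left_comm]

lemma memLp_energy_mul (x : hamiltonianDomain) :
    MemLp (fun k : ℝ => (k : ℂ) * x.1.snd k) 2 energyMeasure := x.2

/-- The photon energy: `(z, ψ) ↦ k ψ(k)`. -/
def energyMul : hamiltonianDomain →ₗ[ℂ] Photon where
  toFun x := (memLp_energy_mul x).toLp _
  map_add' := by
    intro x y
    rw [← MemLp.toLp_add, MemLp.toLp_eq_toLp_iff]
    filter_upwards [Lp.coeFn_add x.1.snd y.1.snd] with k hk
    rw [Submodule.coe_add, WithLp.add_snd, hk, Pi.add_apply, Pi.add_apply, mul_add]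
  map_smul' := by
    intro c x
    rw [RingHom.id_apply, ← MemLp.toLp_const_smul, MemLp.toLp_eq_toLp_iff]
    filter_upwards [Lp.coeFn_smul c x.1.snd] with k hk
    rw [Submodule.coe_smul, WithLp.smul_snd, hk, Pi.smul_apply, Pi.smul_apply, smul_eq_mul,
      smul_eq_mul, mul_left_comm]

/-- The Friedrichs Hamiltonian
`(z, ψ) ↦ (E₀ z + β ⟨g, ψ⟩, β z g + k ψ)` on `ℂ ⊕ L²(0, ∞)`, with its natural domain. -/
def hamiltonian (E₀ β : ℝ) : Space →ₗ.[ℂ] Space where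
  domain := hamiltonianDomain
  toFun :=
    { toFun := fun x => WithLp.toLp 2
        ((E₀ : ℂ) * x.1.fst + (β : ℂ) * inner ℂ gVec x.1.snd,
          ((β : ℂ) * x.1.fst) • gVec + energyMul x)
      map_add' := by
        intro x y
        rw [map_add, ← WithLp.toLp_add, Prod.mk_add_mk, Submodule.coe_add, WithLp.add_fst,
          WithLp.add_snd, inner_add_right]
        congr 2
        · ring
        · rw [mul_add, add_smul]
          abel
      map_smul' := by
        intro c x
        rw [map_smul, RingHom.id_apply, ← WithLp.toLp_smul, Prod.smul_mk, Submodule.coe_smul,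
          WithLp.smul_fst, WithLp.smul_snd, inner_smul_right]
        congr 2
        · simp only [smul_eq_mul]
          ring
        · rw [smul_add, smul_smul, smul_eq_mul, mul_left_comm] }

/-- The Weisskopf–Wigner state: excited atom, no photon. -/
def excited : Space := WithLp.toLp 2 (1, 0)

/-- The return amplitude `(Φ₁, exp (-i t H) Φ₁)` of the Weisskopf–Wigner state `Φ₁`. -/
def returnAmplitude (E₀ β t : ℝ) : ℂ :=
  inner ℂ excited (unitaryGroup (hamiltonian E₀ β) t excited)

end

end Friedrichs

/-! For `z` in the upper half-plane the Laplace transform of the return amplitude is a matrix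
element of the resolvent, `-i (E₀ - z - β² S(z))⁻¹`, where `S` is the Stieltjes transform of `G`
(`integral_exp_mul_returnAmplitude`). Since `G` is rational on the half-line, partial fractions give
`S` in closed form: `G` times a logarithm plus a rational function (`stieltjes_eq`). This formula
continues `S` across the positive axis, where its real part is `F` and its imaginary part is `π G >
0` (`F_eq`, `stieltjesCont_im`). For small `β` the continued denominator therefore has a zero `p`
near `E₀` with `Im p < 0`. The contraction argument that finds `p` also solves the real equation for
`λ₀`.

The pole of the resolvent amplitude at `p` has the coefficient `Z = (1 + β² S'(p))⁻¹ = 1 + K`. The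
heart of the proof is `exists_resonance`: after subtraction of `Z / (p - z)`, the `z`-derivative is
at most `β²` times a fixed integrable weight on all lines `0 < Im z < 1`. The pole approaches the
real axis as `β → 0`, but the numerator vanishes to second order at `p`, which compensates the
double pole uniformly. What remains is a logarithmic singularity at the threshold `z = 0`.
Differentiation of a Laplace transform multiplies the function by `t`, up to a factor `i`, so
Fourier inversion gives `t |R(t) - Z exp (-ipt)| ≤ C β²` (`mul_norm_le_of_laplace`, `exists_decay`).

It remains to replace `p` by `λ₀ - iΓ/2`. At fixed `β` both exponentials decay, so `t` times their
difference tends to zero. The difference goes into `c₁`, of which only a limit at fixed `β` is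
required. The limit `β² d / E₀` is produced by a term `β² / (E₀ t)` that is added to `c₁` and
subtracted from `c₂`; thus `d = 1` is a choice and not an asymptotic coefficient of `R`.

The unitary group exists because `H` is a finite-rank perturbation of a multiplication operator,
whose group is explicit. The interaction picture reduces the perturbed group to a linear
differential equation with a norm-continuous coefficient, solved by its Dyson series
(`IsUnitaryGroup.exists_perturbation`). -/

open MeasureTheory Set Filter Topology

namespace Friedrichs

noncomputable section

/-! ### Linear differential equations in a Banach algebra -/

section Dyson

variable {𝔸 : Type*} [NormedRing 𝔸] [NormedAlgebra ℝ 𝔸] [CompleteSpace 𝔸]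

/-- The terms of the Dyson series for `W' = A W`, `W 0 = 1`. -/
def dyson (A : ℝ → 𝔸) : ℕ → ℝ → 𝔸
  | 0 => fun _ => 1
  | n + 1 => fun t => ∫ s in (0 : ℝ)..t, A s * dyson A n s

lemma hasDerivAt_dyson_succ {A : ℝ → 𝔸} (hA : Continuous A) (n : ℕ) (hn : Continuous (dyson A n))
    (t : ℝ) : HasDerivAt (dyson A (n + 1)) (A t * dyson A n t) t :=
  intervalIntegral.integral_hasDerivAt_right ((hA.mul hn).intervalIntegrable _ _)
    (hA.mul hn).aestronglyMeasurable.stronglyMeasurableAtFilter (hA.mul hn).continuousAt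

lemma continuous_dyson {A : ℝ → 𝔸} (hA : Continuous A) (n : ℕ) : Continuous (dyson A n) := by
  induction n with
  | zero => exact continuous_const
  | succ n ih =>
    exact continuous_iff_continuousAt.2 fun t => (hasDerivAt_dyson_succ hA n ih t).continuousAt

-- Each integration raises the power of `|t|` by one and divides by the new exponent, which builds
-- up the factorial. The factor `‖1‖` is kept because the unit of a normed ring need not have norm
-- one.
omit [CompleteSpace 𝔸] in
lemma norm_dyson_le {A : ℝ → 𝔸} {M : ℝ} (hM : ∀ t, ‖A t‖ ≤ M) (n : ℕ) (t : ℝ) :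
    ‖dyson A n t‖ ≤ ‖(1 : 𝔸)‖ * ((M * |t|) ^ n / n.factorial) := by
  have hM0 : 0 ≤ M := (norm_nonneg _).trans (hM 0)
  induction n generalizing t with
  | zero => simp [dyson]
  | succ n ih =>
    have hint : IntegrableOn (fun s : ℝ => M * (‖(1 : 𝔸)‖ * (M ^ n / n.factorial)) * |s - 0| ^ n)
        (uIoc 0 t) := by
      have : Continuous fun s : ℝ =>
          M * (‖(1 : 𝔸)‖ * (M ^ n / n.factorial)) * |s - 0| ^ n := by fun_prop
      exact (this.integrableOn_uIcc (a := 0) (b := t)).mono_set uIoc_subset_uIcc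
    calc ‖dyson A (n + 1) t‖ ≤ ∫ s in uIoc 0 t, ‖A s * dyson A n s‖ :=
          intervalIntegral.norm_integral_le_integral_norm_uIoc
      _ ≤ ∫ s in uIoc 0 t, M * (‖(1 : 𝔸)‖ * (M ^ n / n.factorial)) * |s - 0| ^ n := by
          refine integral_mono_of_nonneg (ae_of_all _ fun s => norm_nonneg _) hint
            (ae_of_all _ fun s => ?_)
          calc ‖A s * dyson A n s‖ ≤ ‖A s‖ * ‖dyson A n s‖ := norm_mul_le _ _
            _ ≤ M * (‖(1 : 𝔸)‖ * ((M * |s|) ^ n / n.factorial)) := by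
                gcongr
                · exact hM s
                · exact ih s
            _ = _ := by simp only [sub_zero, mul_pow]; ring
      _ = ‖(1 : 𝔸)‖ * ((M * |t|) ^ (n + 1) / (n + 1).factorial) := by
          rw [integral_const_mul, integral_pow_abs_sub_uIoc, sub_zero, Nat.factorial_succ]
          push_cast
          field_simp
          ring

/-- The linear equation `W' = A W` with a bounded continuous coefficient has a global solution. -/
theorem exists_hasDerivAt_mul {A : ℝ → 𝔸} (hA : Continuous A) {M : ℝ} (hM : ∀ t, ‖A t‖ ≤ M) :
    ∃ W : ℝ → 𝔸, W 0 = 1 ∧ ∀ t, HasDerivAt W (A t * W t) t := by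
  have hM0 : 0 ≤ M := (norm_nonneg _).trans (hM 0)
  have hsum : ∀ T : ℝ, Summable fun n : ℕ => ‖(1 : 𝔸)‖ * ((M * T) ^ n / n.factorial) := fun T =>
    (Real.summable_pow_div_factorial (M * T)).mul_left _
  have hs : ∀ t, Summable fun n => dyson A n t := fun t =>
    Summable.of_norm_bounded (hsum |t|) fun n => norm_dyson_le hM n t
  refine ⟨fun t => ∑' n, dyson A n t, ?_, fun t => ?_⟩
  · refine (tsum_eq_single 0 fun n hn => ?_).trans rfl
    obtain ⟨n, rfl⟩ := Nat.exists_eq_succ_of_ne_zero hn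
    simp [dyson]
  · set T := |t| + 1
    -- The constant term has derivative zero, and every other term has as derivative `A` times its
    -- predecessor. Shifting the index turns the sum of the derivatives into `A` times the series.
    let g' : ℕ → ℝ → 𝔸 := fun n s => n.casesOn 0 fun m => A s * dyson A m s
    have hu : Summable fun n : ℕ => (n.casesOn 0 fun m =>
        M * (‖(1 : 𝔸)‖ * ((M * T) ^ m / m.factorial)) : ℝ) :=
      (summable_nat_add_iff 1).1 ((hsum T).mul_left M)
    have hd := hasDerivAt_tsum_of_isPreconnected (g := dyson A) (g' := g') hu
      (isOpen_Ioo (a := -T) (b := T)) isPreconnected_Ioo (y₀ := 0) (y := t) ?_ ?_ ?_ (hs 0) ?_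
    · have he : ∑' n, g' n t = A t * ∑' n, dyson A n t := by
        rw [← (hs t).tsum_mul_left (A t), Summable.tsum_eq_zero_add]
        · exact zero_add _
        · exact (summable_nat_add_iff 1).1 ((hs t).mul_left (A t))
      rwa [he] at hd
    · intro n s _
      cases n with
      | zero => exact hasDerivAt_const s 1
      | succ n => exact hasDerivAt_dyson_succ hA n (continuous_dyson hA n) s
    · intro n s hs
      cases n with
      | zero => simp [g']
      | succ n =>
        have hsT : |s| ≤ T := (abs_lt.2 hs).le
        calc ‖A s * dyson A n s‖ ≤ ‖A s‖ * ‖dyson A n s‖ := norm_mul_le _ _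
          _ ≤ M * (‖(1 : 𝔸)‖ * ((M * T) ^ n / n.factorial)) := by
            gcongr
            · exact hM s
            · refine (norm_dyson_le hM n s).trans ?_
              gcongr
    · constructor <;> simp only [T] <;> linarith [abs_nonneg t]
    · constructor <;> simp only [T] <;> linarith [neg_abs_le t, le_abs_self t]

omit [CompleteSpace 𝔸] in
/-- Uniqueness for `W' = A W` with a bounded coefficient. -/
theorem eq_of_hasDerivAt_mul {A : ℝ → 𝔸} {M : ℝ} (hM : ∀ t, ‖A t‖ ≤ M) {X Y : ℝ → 𝔸}
    (hX : ∀ t, HasDerivAt X (A t * X t) t) (hY : ∀ t, HasDerivAt Y (A t * Y t) t)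
    (h0 : X 0 = Y 0) : X = Y := by
  refine ODE_solution_unique_univ (v := fun t x => A t * x) (K := M.toNNReal)
    (s := fun _ => univ) (t₀ := 0) (fun t => ?_) (fun t => ⟨hX t, mem_univ _⟩)
    (fun t => ⟨hY t, mem_univ _⟩) h0
  refine LipschitzWith.lipschitzOnWith (LipschitzWith.of_dist_le_mul fun x y => ?_)
  rw [dist_eq_norm, dist_eq_norm, ← mul_sub]
  exact (norm_mul_le _ _).trans (by gcongr; exact (hM t).trans (Real.le_coe_toNNReal M))

end Dyson

/-! ### Bounded perturbations of generators -/

section Perturbation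

variable {E : Type*} [NormedAddCommGroup E] [InnerProductSpace ℂ E] [CompleteSpace E]
  {A : E →ₗ.[ℂ] E} {U : ℝ → E →L[ℂ] E}

open ContinuousLinearMap

lemma IsUnitaryGroup.neg_mul_self (h : IsUnitaryGroup A U) (t : ℝ) : U (-t) * U t = 1 := by
  rw [← h.add, neg_add_cancel, h.zero]

lemma IsUnitaryGroup.mul_neg_self (h : IsUnitaryGroup A U) (t : ℝ) : U t * U (-t) = 1 := by
  rw [← h.add, add_neg_cancel, h.zero]

lemma IsUnitaryGroup.star_eq (h : IsUnitaryGroup A U) (t : ℝ) : star (U t) = U (-t) :=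
  left_inv_eq_right_inv (Unitary.star_mul_self_of_mem (h.unitary t)) (h.mul_neg_self t)

lemma IsUnitaryGroup.norm_apply (h : IsUnitaryGroup A U) (t : ℝ) (x : E) : ‖U t x‖ = ‖x‖ :=
  ContinuousLinearMap.norm_map_of_mem_unitary (h.unitary t) x

lemma IsUnitaryGroup.opNorm_le (h : IsUnitaryGroup A U) (t : ℝ) : ‖U t‖ ≤ 1 :=
  ContinuousLinearMap.opNorm_le_bound _ zero_le_one fun x => by rw [h.norm_apply, one_mul]

/-- An isometry does not enlarge an error in the vector, so strong continuity becomes joint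
continuity. This allows limits in which the time and the vector vary together. -/
lemma IsUnitaryGroup.continuous_uncurry (h : IsUnitaryGroup A U) :
    Continuous fun p : ℝ × E => U p.1 p.2 := by
  rw [continuous_iff_continuousAt]
  rintro ⟨t, x⟩
  have h1 : Tendsto (fun p : ℝ × E => U p.1 (p.2 - x)) (𝓝 (t, x)) (𝓝 0) := by
    rw [tendsto_zero_iff_norm_tendsto_zero]
    simp only [h.norm_apply]
    have : Continuous fun p : ℝ × E => ‖p.2 - x‖ := by fun_prop
    simpa using this.tendsto (t, x)
  have h2 : Tendsto (fun p : ℝ × E => U p.1 x) (𝓝 (t, x)) (𝓝 (U t x)) :=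
    ((h.continuous x).comp continuous_fst).tendsto (t, x)
  have h3 := h1.add h2
  rw [zero_add] at h3
  refine h3.congr fun p => ?_
  rw [map_sub, sub_add_cancel]

/-- The interaction picture: a bounded self-adjoint perturbation `B` of the generator of a unitary
group again generates a unitary group, if `t ↦ U (-t) B U t` is continuous in norm. -/
theorem IsUnitaryGroup.exists_perturbation (h : IsUnitaryGroup A U) {B : E →L[ℂ] E}
    (hB : IsSelfAdjoint B) (hc : Continuous fun t => U (-t) * B * U t) {A' : E →ₗ.[ℂ] E}
    (hA' : ∀ x y, (x, y) ∈ A'.graph ↔ (x, y - B x) ∈ A.graph) :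
    ∃ U' : ℝ → E →L[ℂ] E, IsUnitaryGroup A' U' := by
  -- The perturbed group is sought as `U t * W t`. Formally this forces `W' = V W`; as `V` is
  -- skew-adjoint, `W` is unitary.
  set V : ℝ → E →L[ℂ] E := fun t => (-Complex.I) • (U (-t) * B * U t) with hV
  have hVc : Continuous V := hc.const_smul (-Complex.I)
  have hVM : ∀ t, ‖V t‖ ≤ ‖B‖ := fun t => by
    calc ‖V t‖ = ‖U (-t) * B * U t‖ := by simp [hV, norm_smul]
      _ ≤ ‖U (-t)‖ * ‖B‖ * ‖U t‖ := by
        refine (norm_mul_le _ _).trans ?_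
        gcongr
        exact norm_mul_le _ _
      _ ≤ 1 * ‖B‖ * 1 := by
        gcongr
        · exact h.opNorm_le _
        · exact h.opNorm_le _
      _ = ‖B‖ := by ring
  have hVs : ∀ t, star (V t) = -V t := fun t => by
    simp only [hV, star_smul, star_mul, h.star_eq, hB.star_eq, neg_neg, star_neg, mul_assoc,
      Complex.star_def, Complex.conj_I, neg_smul]
  obtain ⟨W, hW0, hW⟩ := exists_hasDerivAt_mul hVc hVM
  have hWs : ∀ t, HasDerivAt (fun s => star (W s)) (-(star (W t) * V t)) t := fun t => by
    have := (hW t).star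
    rwa [star_mul, hVs, mul_neg] at this
  have hWl : ∀ t, star (W t) * W t = 1 := fun t => by
    have hd : ∀ s, HasDerivAt (fun s => star (W s) * W s) 0 s := fun s => by
      refine ((hWs s).mul (hW s)).congr_deriv ?_
      noncomm_ring
    have := is_const_of_deriv_eq_zero (fun s => (hd s).differentiableAt)
      (fun s => (hd s).deriv) t 0
    simpa [hW0] using this
  -- In infinite dimension this does not follow from `hWl`. Both `W * star W` and the constant `1`
  -- solve `X' = V X - X V` with the same initial value.
  have hWr : ∀ t, W t * star (W t) = 1 := fun t => by
    have hd : ∀ s, HasDerivAt (fun s => W s * star (W s))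
        (V s * (W s * star (W s)) - W s * star (W s) * V s) s := fun s => by
      refine ((hW s).mul (hWs s)).congr_deriv ?_
      noncomm_ring
    refine congr_fun (ODE_solution_unique_univ (v := fun t x => V t * x - x * V t)
      (K := (2 * ‖B‖).toNNReal) (s := fun _ => univ) (t₀ := 0) (fun t => ?_)
      (fun t => ⟨hd t, mem_univ _⟩) (fun t => ⟨?_, mem_univ _⟩) ?_) t (g := fun _ => 1)
    · refine LipschitzWith.lipschitzOnWith (LipschitzWith.of_dist_le_mul fun x y => ?_)
      rw [dist_eq_norm, dist_eq_norm, Real.coe_toNNReal _ (by positivity)]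
      calc ‖V t * x - x * V t - (V t * y - y * V t)‖ = ‖V t * (x - y) - (x - y) * V t‖ := by
            congr 1
            noncomm_ring
        _ ≤ ‖V t‖ * ‖x - y‖ + ‖x - y‖ * ‖V t‖ :=
            (norm_sub_le _ _).trans (add_le_add (norm_mul_le _ _) (norm_mul_le _ _))
        _ = 2 * ‖V t‖ * ‖x - y‖ := by ring
        _ ≤ 2 * ‖B‖ * ‖x - y‖ := by
            gcongr
            exact hVM t
    · simpa using hasDerivAt_const t (1 : E →L[ℂ] E)
    · simp [hW0]
  have hcomm : ∀ s t, U s * V (t + s) = V t * U s := fun s t => by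
    simp only [hV, mul_smul_comm, smul_mul_assoc, ← mul_assoc]
    rw [← h.add, mul_assoc (U (-t) * B), ← h.add]
    congr 3
    ring_nf
  -- This cocycle identity is the group law for `U t * W t`. After multiplication by the inverse of
  -- `U s * W s`, both sides solve `X' = V X` with `X 0 = 1`, by the covariance `hcomm`.
  have hgroup : ∀ s t, W t * U s * W s = U s * W (t + s) := fun s t => by
    have hY : ∀ t, HasDerivAt (fun t => U s * W (t + s) * (star (W s) * U (-s)))
        (V t * (U s * W (t + s) * (star (W s) * U (-s)))) t := fun t => by
      have h1 : HasDerivAt (fun t => W (t + s)) (V (t + s) * W (t + s)) t :=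
        (hW (t + s)).comp_add_const t s
      refine ((h1.const_mul (U s)).mul_const (star (W s) * U (-s))).congr_deriv ?_
      rw [← mul_assoc (U s), hcomm]
      noncomm_ring
    have h0 := congr_fun (eq_of_hasDerivAt_mul hVM hW hY (by
      rw [hW0, zero_add, mul_assoc, ← mul_assoc (W s), hWr, one_mul, h.mul_neg_self])) t
    calc W t * U s * W s
        = U s * W (t + s) * (star (W s) * ((U (-s) * U s) * W s)) := by
          rw [h0]
          noncomm_ring
      _ = U s * W (t + s) := by rw [h.neg_mul_self, one_mul, hWl, mul_one]
  have hcont : Continuous W := continuous_iff_continuousAt.2 fun t => (hW t).continuousAt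
  refine ⟨fun t => U t * W t, ?_, fun s t => ?_, fun t => ?_, fun x => ?_, fun x y => ?_⟩
  · simp only [h.zero, hW0, one_mul]
  · rw [mul_assoc (U s), ← mul_assoc (W s), hgroup, ← mul_assoc, ← h.add]
  · exact mul_mem (h.unitary t) (Unitary.mem_iff.2 ⟨hWl t, hWr t⟩)
  · exact h.continuous_uncurry.comp (continuous_id.prodMk (hcont.clm_apply continuous_const))
  -- The term `U t (W t x - x)` is differentiable at zero for every vector `x`, in the domain or
  -- not. Hence `U t W t x` and `U t x` are differentiable at zero for the same `x`, and the domain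
  -- does not change.
  · have hP : HasDerivAt (fun t => U t (W t x - x)) (-(Complex.I • B x)) 0 := by
      have h1 : HasDerivAt (fun t => W t x) (-(Complex.I • B x)) 0 := by
        refine (((ContinuousLinearMap.apply ℂ E x).restrictScalars ℝ).hasFDerivAt.comp_hasDerivAt
          (0 : ℝ) (hW 0)).congr_deriv ?_
        change (V 0 * W 0) x = _
        simp [hV, h.zero, hW0]
      rw [hasDerivAt_iff_tendsto_slope] at h1 ⊢
      have h2 := h.continuous_uncurry.tendsto (0, -(Complex.I • B x))
      rw [h.zero] at h2
      refine (h2.comp ((tendsto_nhdsWithin_of_tendsto_nhds tendsto_id).prodMk_nhds h1)).congr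
        fun t => ?_
      have e : ∀ r : ℝ, ∀ z, U t (r • z) = r • U t z := fun r z =>
        (U t).toLinearMap.map_smul_of_tower r z
      simp [slope_def_module, hW0, e]
    rw [hA', h.generator]
    have e1 : -(Complex.I • y) = -(Complex.I • (y - B x)) + -(Complex.I • B x) := by
      rw [smul_sub]
      abel
    have e2 : (fun t => (U t * W t) x) = fun t => U t x + U t (W t x - x) := by
      ext t
      simp
    rw [e1, e2]
    refine ⟨fun hd => hd.add hP, fun hd => ?_⟩
    refine (hd.sub hP).congr_deriv (add_sub_cancel_right _ _) |>.congr_of_eventuallyEq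
      (Eventually.of_forall fun t => ?_)
    simp

end Perturbation

/-! ### The free evolution -/

lemma norm_sq_eq_integral (f : Photon) : ‖f‖ ^ 2 = ∫ k, ‖f k‖ ^ 2 ∂energyMeasure := by
  have h : inner ℂ f f = ((∫ k, ‖f k‖ ^ 2 ∂energyMeasure : ℝ) : ℂ) := by
    rw [L2.inner_def, ← integral_complex_ofReal]
    refine integral_congr_ae (ae_of_all _ fun k => ?_)
    simp only [inner_self_eq_norm_sq_to_K]
    norm_cast
  rw [inner_self_eq_norm_sq_to_K] at h
  exact Complex.ofReal_injective ((Complex.ofReal_pow _ _).trans h)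

/-- Dominated convergence in `L²`. -/
lemma tendsto_photon_zero {ι : Type*} {l : Filter ι} [l.IsCountablyGenerated] {f : ι → Photon}
    {m : ι → ℝ → ℂ} {b : ℝ → ℝ} (hb : MemLp b 2 energyMeasure)
    (hf : ∀ i, f i =ᵐ[energyMeasure] m i) (hm : ∀ i, ∀ᵐ k ∂energyMeasure, ‖m i k‖ ≤ b k)
    (hlim : ∀ᵐ k ∂energyMeasure, Tendsto (fun i => m i k) l (𝓝 0)) : Tendsto f l (𝓝 0) := by
  rw [tendsto_zero_iff_norm_tendsto_zero]
  have h1 : Tendsto (fun i => ‖f i‖ ^ 2) l (𝓝 0) := by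
    have h2 : ∀ i, ‖f i‖ ^ 2 = ∫ k, ‖m i k‖ ^ 2 ∂energyMeasure := fun i => by
      rw [norm_sq_eq_integral]
      refine integral_congr_ae ?_
      filter_upwards [hf i] with k hk
      rw [hk]
    simp only [h2]
    have h3 := tendsto_integral_filter_of_dominated_convergence (μ := energyMeasure) (l := l)
      (F := fun i k => ‖m i k‖ ^ 2) (f := fun _ => 0) (fun k => b k ^ 2)
      (Eventually.of_forall fun i =>
        ((Lp.aestronglyMeasurable (f i)).congr (hf i)).norm.pow 2)
      (Eventually.of_forall fun i => ?_) ?_ ?_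
    · simpa using h3
    · filter_upwards [hm i] with k hk
      rw [Real.norm_of_nonneg (by positivity)]
      gcongr
    · exact (memLp_two_iff_integrable_sq hb.1).1 hb
    · filter_upwards [hlim] with k hk
      simpa using (hk.norm).pow 2
  have h2 := h1.sqrt
  simpa [Real.sqrt_sq] using h2

/-- The factor `exp (-i k t)`. -/
def phase (t k : ℝ) : ℂ := Complex.exp (Complex.I * ((-(k * t) : ℝ) : ℂ))

lemma norm_phase (t k : ℝ) : ‖phase t k‖ = 1 := by
  rw [phase, mul_comm, Complex.norm_exp_ofReal_mul_I]

lemma continuous_phase (t : ℝ) : Continuous (phase t) := by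
  unfold phase
  fun_prop

lemma continuous_phase_left (k : ℝ) : Continuous fun t => phase t k := by
  unfold phase
  fun_prop

lemma phase_zero (k : ℝ) : phase 0 k = 1 := by simp [phase]

lemma phase_add (s t k : ℝ) : phase (s + t) k = phase s k * phase t k := by
  rw [phase, phase, phase, ← Complex.exp_add]
  congr 1
  push_cast
  ring

lemma norm_phase_sub_one_le (t k : ℝ) : ‖phase t k - 1‖ ≤ |k * t| := by
  have := Real.norm_exp_I_mul_ofReal_sub_one_le (x := -(k * t))
  rwa [Real.norm_eq_abs, abs_neg] at this

lemma hasDerivAt_phase (k : ℝ) : HasDerivAt (fun t => phase t k) (-(Complex.I * k)) 0 := by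
  have h1 : HasDerivAt (fun t : ℝ => Complex.I * ((-(k * t) : ℝ) : ℂ)) (-(Complex.I * k)) 0 := by
    have := (((hasDerivAt_id (0 : ℝ)).const_mul k).neg.ofReal_comp).const_mul Complex.I
    simpa using this
  simpa [phase] using h1.cexp

lemma memLp_phase_mul (t : ℝ) (f : Photon) :
    MemLp (fun k => phase t k * f k) 2 energyMeasure :=
  (Lp.memLp f).of_le ((continuous_phase t).aestronglyMeasurable.mul (Lp.aestronglyMeasurable f))
    (ae_of_all _ fun k => by rw [norm_mul, norm_phase, one_mul])

/-- Multiplication by `exp (-i k t)`. -/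
def photonGroup (t : ℝ) : Photon →ₗᵢ[ℂ] Photon where
  toFun f := (memLp_phase_mul t f).toLp _
  map_add' f h := by
    rw [← MemLp.toLp_add, MemLp.toLp_eq_toLp_iff]
    filter_upwards [Lp.coeFn_add f h] with k hk
    rw [hk, Pi.add_apply, Pi.add_apply, mul_add]
  map_smul' c f := by
    rw [RingHom.id_apply, ← MemLp.toLp_const_smul, MemLp.toLp_eq_toLp_iff]
    filter_upwards [Lp.coeFn_smul c f] with k hk
    rw [hk, Pi.smul_apply, Pi.smul_apply, smul_eq_mul, smul_eq_mul, mul_left_comm]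
  norm_map' f := by
    have h : ‖(memLp_phase_mul t f).toLp _‖ ^ 2 = ‖f‖ ^ 2 := by
      rw [norm_sq_eq_integral, norm_sq_eq_integral]
      refine integral_congr_ae ?_
      filter_upwards [(memLp_phase_mul t f).coeFn_toLp] with k hk
      rw [hk, norm_mul, norm_phase, one_mul]
    exact (sq_eq_sq₀ (norm_nonneg _) (norm_nonneg _)).1 h

lemma coeFn_photonGroup (t : ℝ) (f : Photon) :
    photonGroup t f =ᵐ[energyMeasure] fun k => phase t k * f k :=
  (memLp_phase_mul t f).coeFn_toLp

lemma photonGroup_zero (f : Photon) : photonGroup 0 f = f := by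
  refine Lp.ext ?_
  filter_upwards [coeFn_photonGroup 0 f] with k hk
  rw [hk, phase_zero, one_mul]

lemma photonGroup_add (s t : ℝ) (f : Photon) :
    photonGroup (s + t) f = photonGroup s (photonGroup t f) := by
  refine Lp.ext ?_
  filter_upwards [coeFn_photonGroup (s + t) f, coeFn_photonGroup s (photonGroup t f),
    coeFn_photonGroup t f] with k h1 h2 h3
  rw [h1, h2, h3, phase_add, mul_assoc]

lemma continuous_photonGroup (f : Photon) : Continuous fun t => photonGroup t f := by
  rw [continuous_iff_continuousAt]
  intro t
  rw [ContinuousAt, ← tendsto_sub_nhds_zero_iff]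
  refine tendsto_photon_zero (m := fun s k => phase s k * f k - phase t k * f k)
    (b := fun k => 2 * ‖f k‖) ((Lp.memLp f).norm.const_mul 2) (fun s => ?_) (fun s => ?_) ?_
  · filter_upwards [Lp.coeFn_sub (photonGroup s f) (photonGroup t f), coeFn_photonGroup s f,
      coeFn_photonGroup t f] with k h1 h2 h3
    rw [h1, Pi.sub_apply, h2, h3]
  · refine ae_of_all _ fun k => (norm_sub_le _ _).trans ?_
    rw [norm_mul, norm_mul, norm_phase, norm_phase]
    linarith
  · refine ae_of_all _ fun k => ?_
    rw [tendsto_sub_nhds_zero_iff]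
    exact ((continuous_phase_left k).tendsto t).mul_const _

/-- The generator of multiplication by `exp (-i k t)` is multiplication by `-i k`, with its
maximal domain. -/
lemma hasDerivAt_photonGroup_iff (f h : Photon) :
    HasDerivAt (fun t => photonGroup t f) (-(Complex.I • h)) 0 ↔
      h =ᵐ[energyMeasure] fun k => (k : ℂ) * f k := by
  have hsl : ∀ t : ℝ, slope (fun t => photonGroup t f) 0 t =ᵐ[energyMeasure]
      fun k => slope (fun t => phase t k) 0 t * f k := fun t => by
    simp only [slope_def_module, sub_zero, photonGroup_zero, phase_zero]
    filter_upwards [Lp.coeFn_smul (t⁻¹ : ℝ) (photonGroup t f - f), Lp.coeFn_sub (photonGroup t f) f,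
      coeFn_photonGroup t f] with k h1 h2 h3
    rw [h1, Pi.smul_apply, h2, Pi.sub_apply, h3, smul_mul_assoc, sub_mul, one_mul]
  rw [hasDerivAt_iff_tendsto_slope]
  constructor
  · intro hd
    -- Convergence in `L²` gives convergence almost everywhere only along a subsequence, so the
    -- difference quotients are first restricted to a sequence of times.
    have hseq : Tendsto (fun n : ℕ => 1 / ((n : ℝ) + 1)) atTop (𝓝[≠] 0) :=
      tendsto_nhdsWithin_iff.2 ⟨tendsto_one_div_add_atTop_nhds_zero_nat,
        Eventually.of_forall fun n => by simpa using Nat.cast_add_one_ne_zero n⟩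
    obtain ⟨ns, hns, hae⟩ :=
      (tendstoInMeasure_of_tendsto_Lp (hd.comp hseq)).exists_seq_tendsto_ae
    have hall := ae_all_iff.2 fun n : ℕ => hsl (1 / ((n : ℝ) + 1))
    filter_upwards [hae, hall, Lp.coeFn_neg (Complex.I • h), Lp.coeFn_smul Complex.I h]
      with k h1 h2 h3 h4
    rw [h3, Pi.neg_apply, h4, Pi.smul_apply] at h1
    have h5 : Tendsto (fun i => slope (fun t => phase t k) 0 (1 / ((ns i : ℝ) + 1)) * f k) atTop
        (𝓝 (-(Complex.I * k) * f k)) :=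
      (((hasDerivAt_iff_tendsto_slope.1 (hasDerivAt_phase k)).comp hseq).comp
        hns.tendsto_atTop).mul_const _
    have h6 := tendsto_nhds_unique h1 (h5.congr fun i => (h2 (ns i)).symm)
    rw [smul_eq_mul, neg_mul, neg_inj, mul_assoc] at h6
    exact mul_left_cancel₀ Complex.I_ne_zero h6
  · intro hh
    have hmem : MemLp (fun k => 2 * ‖h k‖) 2 energyMeasure := (Lp.memLp h).norm.const_mul 2
    rw [← tendsto_sub_nhds_zero_iff]
    refine tendsto_photon_zero
      (m := fun t k => slope (fun t => phase t k) 0 t * f k - (-(Complex.I * k) * f k))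
      hmem (fun t => ?_) (fun t => ?_) ?_
    · filter_upwards [hsl t, hh, Lp.coeFn_neg (Complex.I • h), Lp.coeFn_smul Complex.I h,
        Lp.coeFn_sub (slope (fun t => photonGroup t f) 0 t) (-(Complex.I • h))] with k h1 h2 h3 h4 h5
      rw [h5, Pi.sub_apply, h1, h3, Pi.neg_apply, h4, Pi.smul_apply, h2, smul_eq_mul]
      ring
    · filter_upwards [hh] with k hk
      rw [hk]
      have h1 : ‖slope (fun t => phase t k) 0 t‖ ≤ |k| := by
        rw [slope_def_module, sub_zero, phase_zero, norm_smul, norm_inv, Real.norm_eq_abs]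
        rcases eq_or_ne t 0 with rfl | ht
        · simp
        · rw [inv_mul_le_iff₀ (abs_pos.2 ht), ← abs_mul, mul_comm]
          exact norm_phase_sub_one_le t k
      calc ‖slope (fun t => phase t k) 0 t * f k - (-(Complex.I * k) * f k)‖
          ≤ ‖slope (fun t => phase t k) 0 t‖ * ‖f k‖ + |k| * ‖f k‖ := by
            refine (norm_sub_le _ _).trans ?_
            simp
        _ ≤ |k| * ‖f k‖ + |k| * ‖f k‖ := by gcongr
        _ = 2 * ‖(k : ℂ) * f k‖ := by
            rw [norm_mul, Complex.norm_real, Real.norm_eq_abs]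
            ring
    · refine ae_of_all _ fun k => ?_
      rw [tendsto_sub_nhds_zero_iff]
      exact (hasDerivAt_iff_tendsto_slope.1 (hasDerivAt_phase k)).mul_const _

/-- The free evolution `(z, ψ) ↦ (z, exp (-i k t) ψ)` as a linear isometry. -/
def freeIsometry (t : ℝ) : Space →ₗᵢ[ℂ] Space where
  toFun x := WithLp.toLp 2 (x.fst, photonGroup t x.snd)
  map_add' x y := by
    rw [WithLp.add_fst, WithLp.add_snd, map_add]
    rfl
  map_smul' c x := by
    rw [WithLp.smul_fst, WithLp.smul_snd, map_smul]
    rfl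
  norm_map' x := by
    refine (sq_eq_sq₀ (norm_nonneg _) (norm_nonneg _)).1 ?_
    rw [WithLp.prod_norm_sq_eq_of_L2, WithLp.prod_norm_sq_eq_of_L2]
    simp

/-- The free evolution. -/
def freeGroup (t : ℝ) : Space →L[ℂ] Space := (freeIsometry t).toContinuousLinearMap

lemma freeGroup_apply (t : ℝ) (x : Space) :
    freeGroup t x = WithLp.toLp 2 (x.fst, photonGroup t x.snd) := rfl

lemma hasDerivAt_space_iff {f : ℝ → Space} {f' : Space} {t : ℝ} :
    HasDerivAt f f' t ↔
      HasDerivAt (fun s => (f s).fst) f'.fst t ∧ HasDerivAt (fun s => (f s).snd) f'.snd t := by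
  constructor
  · intro h
    exact ⟨((WithLp.fstL 2 ℂ ℂ Photon).restrictScalars ℝ).hasFDerivAt.comp_hasDerivAt t h,
      ((WithLp.sndL 2 ℂ ℂ Photon).restrictScalars ℝ).hasFDerivAt.comp_hasDerivAt t h⟩
  · rintro ⟨h1, h2⟩
    exact ((WithLp.prodContinuousLinearEquiv 2 ℂ ℂ Photon).symm.toContinuousLinearMap.restrictScalars
      ℝ).hasFDerivAt.comp_hasDerivAt t (h1.prodMk h2)

/-- The domain condition is implicit on the right: the left side of the almost-everywhere equality
is an `L²` function, which forces `k ψ(k)` to be square-integrable. -/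
lemma mem_graph_hamiltonian_iff (E₀ β : ℝ) (x y : Space) :
    (x, y) ∈ (hamiltonian E₀ β).graph ↔
      y.fst = (E₀ : ℂ) * x.fst + (β : ℂ) * inner ℂ gVec x.snd ∧
        ((y.snd - ((β : ℂ) * x.fst) • gVec : Photon) : ℝ → ℂ) =ᵐ[energyMeasure]
          fun k => (k : ℂ) * x.snd k := by
  rw [LinearPMap.mem_graph_iff]
  constructor
  · rintro ⟨z, rfl, rfl⟩
    refine ⟨rfl, ?_⟩
    have : ((hamiltonian E₀ β z).snd - ((β : ℂ) * z.1.fst) • gVec : Photon) = energyMul z :=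
      add_sub_cancel_left _ _
    rw [this]
    exact (memLp_energy_mul z).coeFn_toLp
  · rintro ⟨h1, h2⟩
    have hx : x ∈ hamiltonianDomain :=
      (memLp_congr_ae h2).1 (Lp.memLp (y.snd - ((β : ℂ) * x.fst) • gVec))
    refine ⟨⟨x, hx⟩, rfl, ?_⟩
    have h3 : energyMul ⟨x, hx⟩ = y.snd - ((β : ℂ) * x.fst) • gVec :=
      Lp.ext ((memLp_energy_mul ⟨x, hx⟩).coeFn_toLp.trans h2.symm)
    have h4 : hamiltonian E₀ β ⟨x, hx⟩ = WithLp.toLp 2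
        ((E₀ : ℂ) * x.fst + (β : ℂ) * inner ℂ gVec x.snd,
          ((β : ℂ) * x.fst) • gVec + energyMul ⟨x, hx⟩) := rfl
    rw [h4, h3, ← h1, add_sub_cancel]
    rfl

/-- The unperturbed operator is `0 ⊕ k`, with the atomic energy left out; both `E₀` and `β` are put
into the bounded perturbation. An isometry is unitary once it has a right inverse, here the
evolution for time `-t`. -/
theorem isUnitaryGroup_freeGroup : IsUnitaryGroup (hamiltonian 0 0) freeGroup where
  zero := by
    ext1 x
    rw [freeGroup_apply, photonGroup_zero]
    rfl
  add s t := by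
    ext1 x
    change _ = freeGroup s (freeGroup t x)
    rw [freeGroup_apply, freeGroup_apply, freeGroup_apply, photonGroup_add]
    rfl
  unitary t := by
    have hl : ∀ t, star (freeGroup t) * freeGroup t = 1 := fun t =>
      (ContinuousLinearMap.norm_map_iff_adjoint_comp_self (freeGroup t)).1
        fun x => (freeIsometry t).norm_map x
    have hm : freeGroup t * freeGroup (-t) = 1 := by
      ext1 x
      change freeGroup t (freeGroup (-t) x) = _
      change WithLp.toLp 2 (x.fst, photonGroup t (photonGroup (-t) x.snd)) = x
      rw [← photonGroup_add, add_neg_cancel, photonGroup_zero]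
      rfl
    refine Unitary.mem_iff.2 ⟨hl t, ?_⟩
    rw [left_inv_eq_right_inv (hl t) hm, hm]
  continuous x := by
    have h1 : Continuous fun t => ((x.fst, photonGroup t x.snd) : ℂ × Photon) :=
      continuous_const.prodMk (continuous_photonGroup x.snd)
    exact (WithLp.prodContinuousLinearEquiv 2 ℂ ℂ Photon).symm.continuous.comp h1
  generator x y := by
    rw [mem_graph_hamiltonian_iff]
    refine Iff.trans ?_ hasDerivAt_space_iff.symm
    simp only [freeGroup_apply]
    have h1 : (-(Complex.I • y)).snd = -(Complex.I • y.snd) := rfl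
    have h2 : (-(Complex.I • y)).fst = -(Complex.I * y.fst) := rfl
    rw [h1, h2]
    refine and_congr ?_ ?_
    · have h3 : HasDerivAt (fun _ : ℝ => x.fst) 0 0 := hasDerivAt_const _ _
      constructor
      · intro h
        simpa [h] using h3
      · intro h
        have := h.unique h3
        simpa using this
    · simp only [Complex.ofReal_zero, zero_mul, zero_smul, sub_zero]
      exact (hasDerivAt_photonGroup_iff x.snd y.snd).symm

/-! ### The interacting evolution -/

open InnerProductSpace in
/-- The Hamiltonian without the photon energy. -/
def coupling (E₀ β : ℝ) : Space →L[ℂ] Space :=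
  (E₀ : ℂ) • rankOne ℂ excited excited +
    (β : ℂ) • (rankOne ℂ excited (WithLp.toLp 2 (0, gVec)) +
      rankOne ℂ (WithLp.toLp 2 (0, gVec)) excited)

lemma inner_excited (x : Space) : inner ℂ excited x = x.fst := by
  simp [excited, WithLp.prod_inner_apply]

lemma coupling_apply (E₀ β : ℝ) (x : Space) : coupling E₀ β x =
    WithLp.toLp 2 ((E₀ : ℂ) * x.fst + (β : ℂ) * inner ℂ gVec x.snd, ((β : ℂ) * x.fst) • gVec) := by
  have h : inner ℂ (WithLp.toLp 2 ((0 : ℂ), gVec)) x = inner ℂ gVec x.snd := by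
    simp [WithLp.prod_inner_apply]
  simp only [coupling, add_apply, smul_apply, InnerProductSpace.rankOne_apply, inner_excited, h]
  simp only [excited, ← WithLp.toLp_smul,
    ← WithLp.toLp_add, Prod.smul_mk, Prod.mk_add_mk, smul_eq_mul, smul_zero, mul_one, mul_zero,
    add_zero, zero_add, mul_smul]

lemma isSelfAdjoint_coupling (E₀ β : ℝ) : IsSelfAdjoint (coupling E₀ β) := by
  rw [ContinuousLinearMap.isSelfAdjoint_iff']
  simp only [coupling, map_add, map_smulₛₗ, InnerProductSpace.adjoint_rankOne, Complex.conj_ofReal]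
  rw [add_comm (InnerProductSpace.rankOne ℂ (WithLp.toLp 2 ((0 : ℂ), gVec)) excited)]

lemma continuous_rankOne {X E : Type*} [TopologicalSpace X] [NormedAddCommGroup E]
    [InnerProductSpace ℂ E] {f g : X → E} (hf : Continuous f) (hg : Continuous g) :
    Continuous fun t => InnerProductSpace.rankOne ℂ (f t) (g t) :=
  (ContinuousLinearMap.smulRightL ℂ E E).continuous₂.comp
    (((innerSL ℂ).continuous.comp hg).prodMk hf)

/-- Strong continuity of the free group suffices for continuity in norm, because the coupling has
finite rank: conjugation sends `|x⟩⟨y|` to `|U x⟩⟨U y|`, and only the two vectors move. -/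
lemma continuous_freeGroup_coupling (E₀ β : ℝ) :
    Continuous fun t => freeGroup (-t) * coupling E₀ β * freeGroup t := by
  have h : ∀ t x y, freeGroup (-t) * InnerProductSpace.rankOne ℂ x y * freeGroup t =
      InnerProductSpace.rankOne ℂ (freeGroup (-t) x) (freeGroup (-t) y) := fun t x y => by
    rw [ContinuousLinearMap.mul_def, ContinuousLinearMap.mul_def,
      InnerProductSpace.comp_rankOne, InnerProductSpace.rankOne_comp,
      ← ContinuousLinearMap.star_eq_adjoint, isUnitaryGroup_freeGroup.star_eq]
  have hc : ∀ x y : Space, Continuous fun t =>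
      InnerProductSpace.rankOne ℂ (freeGroup (-t) x) (freeGroup (-t) y) := fun x y => by
    have h1 : ∀ z, Continuous fun t => freeGroup (-t) z := fun z =>
      (isUnitaryGroup_freeGroup.continuous z).comp continuous_neg
    exact continuous_rankOne (h1 x) (h1 y)
  simp only [coupling, mul_add, add_mul, mul_smul_comm, smul_mul_assoc, h]
  exact ((hc _ _).fun_const_smul _).fun_add (((hc _ _).fun_add (hc _ _)).fun_const_smul _)

/-- The Friedrichs Hamiltonian generates a unitary group. -/
theorem isUnitaryGroup_unitaryGroup (E₀ β : ℝ) :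
    IsUnitaryGroup (hamiltonian E₀ β) (unitaryGroup (hamiltonian E₀ β)) := by
  refine Classical.epsilon_spec (isUnitaryGroup_freeGroup.exists_perturbation
    (isSelfAdjoint_coupling E₀ β) (continuous_freeGroup_coupling E₀ β) fun x y => ?_)
  rw [mem_graph_hamiltonian_iff, mem_graph_hamiltonian_iff, coupling_apply]
  simp [sub_eq_zero]

/-! ### Laplace transforms -/

lemma norm_exp_I_mul (z : ℂ) (t : ℝ) :
    ‖Complex.exp (Complex.I * z * t)‖ = Real.exp (-(z.im * t)) := by
  rw [Complex.norm_exp]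
  congr 1
  simp

lemma integrableOn_exp_neg {y : ℝ} (hy : 0 < y) :
    IntegrableOn (fun t : ℝ => Real.exp (-(y * t))) (Ioi 0) := by
  simpa only [neg_mul] using integrableOn_exp_mul_Ioi (neg_lt_zero.2 hy) 0

lemma tendsto_exp_neg {y : ℝ} (hy : 0 < y) :
    Tendsto (fun t : ℝ => Real.exp (-(y * t))) atTop (𝓝 0) :=
  Real.tendsto_exp_neg_atTop_nhds_zero.comp (tendsto_id.const_mul_atTop hy)

lemma continuous_exp_I_mul (z : ℂ) : Continuous fun t : ℝ => Complex.exp (Complex.I * z * t) := by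
  fun_prop

lemma integrableOn_exp_mul {f : ℝ → ℂ} (hf : Continuous f) {M : ℝ} (hM : ∀ t, 0 < t → ‖f t‖ ≤ M)
    {z : ℂ} (hz : 0 < z.im) :
    IntegrableOn (fun t : ℝ => Complex.exp (Complex.I * z * t) * f t) (Ioi 0) := by
  refine Integrable.mono' ((integrableOn_exp_neg hz).mul_const M)
    ((continuous_exp_I_mul z).mul hf).aestronglyMeasurable ?_
  filter_upwards [ae_restrict_mem measurableSet_Ioi] with t ht
  rw [norm_mul, norm_exp_I_mul]
  gcongr
  exact hM t ht

section Resolvent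

variable {E : Type*} [NormedAddCommGroup E] [InnerProductSpace ℂ E] [CompleteSpace E]
  {A : E →ₗ.[ℂ] E} {U : ℝ → E →L[ℂ] E}

lemma IsUnitaryGroup.hasDerivAt (h : IsUnitaryGroup A U) {x y : E} (hxy : (x, y) ∈ A.graph)
    (t : ℝ) : HasDerivAt (fun s => U s x) (U t (-(Complex.I • y))) t := by
  have h0 := (h.generator x y).1 hxy
  rw [← sub_self t] at h0
  have h1 := ((U t).restrictScalars ℝ).hasFDerivAt.comp_hasDerivAt t
    (h0.comp_sub_const t t)
  refine h1.congr_of_eventuallyEq (Eventually.of_forall fun s => ?_)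
  change U s x = (U t * U (s - t)) x
  rw [← h.add, add_sub_cancel]

lemma IsUnitaryGroup.norm_inner_le (h : IsUnitaryGroup A U) (x y : E) (t : ℝ) :
    ‖inner ℂ x (U t y)‖ ≤ ‖x‖ * ‖y‖ :=
  (norm_inner_le_norm _ _).trans_eq (by rw [h.norm_apply])

/-- The Laplace transform of a unitary group is the resolvent of its generator. -/
theorem IsUnitaryGroup.integral_exp_mul_inner (h : IsUnitaryGroup A U) {z : ℂ} (hz : 0 < z.im)
    {x y : E} (hx : (x, y + z • x) ∈ A.graph) (w : E) :
    ∫ t in Ioi (0 : ℝ), Complex.exp (Complex.I * z * t) * inner ℂ w (U t y) =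
      -(Complex.I * inner ℂ w x) := by
  -- The hypothesis on the graph says `(A - z) x = y`, so `x` is the resolvent applied to `y`. The
  -- derivative of `exp (i z t) U t x` is then `-i exp (i z t) U t y`, and the integral telescopes.
  have hd : ∀ t : ℝ, HasDerivAt (fun t : ℝ => Complex.exp (Complex.I * z * t) * inner ℂ w (U t x))
      (-Complex.I * (Complex.exp (Complex.I * z * t) * inner ℂ w (U t y))) t := fun t => by
    have h1 : HasDerivAt (fun t : ℝ => Complex.exp (Complex.I * z * t))
        (Complex.exp (Complex.I * z * t) * (Complex.I * z)) t := by
      have := ((hasDerivAt_id t).ofReal_comp.const_mul (Complex.I * z)).cexp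
      simpa using this
    have h2 : HasDerivAt (fun t : ℝ => inner ℂ w (U t x))
        (inner ℂ w (U t (-(Complex.I • (y + z • x))))) t :=
      ((innerSL ℂ w).restrictScalars ℝ).hasFDerivAt.comp_hasDerivAt t (h.hasDerivAt hx t)
    refine (h1.mul h2).congr_deriv ?_
    simp only [map_neg, map_smul, map_add, inner_neg_right, inner_smul_right, inner_add_right]
    ring
  have hlim : Tendsto (fun t : ℝ => Complex.exp (Complex.I * z * t) * inner ℂ w (U t x)) atTop
      (𝓝 0) := by
    refine squeeze_zero_norm (a := fun t => Real.exp (-(z.im * t)) * (‖w‖ * ‖x‖)) (fun t => ?_) ?_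
    · rw [norm_mul, norm_exp_I_mul]
      gcongr
      exact h.norm_inner_le _ _ _
    · simpa using (tendsto_exp_neg hz).mul_const (‖w‖ * ‖x‖)
  have hc : Continuous fun t => inner ℂ w (U t y) := (continuous_const.inner (h.continuous y))
  have hint := integrableOn_exp_mul hc (fun t _ => h.norm_inner_le w y t) hz
  have h3 := integral_Ioi_of_hasDerivAt_of_tendsto' (fun t _ => hd t) (hint.const_mul _) hlim
  rw [integral_const_mul, h.zero] at h3
  simp only [Complex.ofReal_zero, mul_zero, Complex.exp_zero, one_mul, zero_sub,
    one_apply_eq_self] at h3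
  linear_combination Complex.I * h3 +
    (∫ t in Ioi (0 : ℝ), Complex.exp (Complex.I * z * t) * inner ℂ w (U t y)) * Complex.I_sq

end Resolvent

/-- The Laplace transform of a bounded function is differentiable in the upper half-plane. -/
lemma hasDerivAt_integral_exp_mul {f : ℝ → ℂ} (hf : Continuous f) {M : ℝ}
    (hM : ∀ t, 0 < t → ‖f t‖ ≤ M) {z : ℂ} (hz : 0 < z.im) :
    IntegrableOn (fun t : ℝ => t * Complex.exp (Complex.I * z * t) * f t) (Ioi 0) ∧
    HasDerivAt (fun z => ∫ t in Ioi (0 : ℝ), Complex.exp (Complex.I * z * t) * f t)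
      (Complex.I * ∫ t in Ioi (0 : ℝ), t * Complex.exp (Complex.I * z * t) * f t) z := by
  have hM0 : 0 ≤ M := (norm_nonneg _).trans (hM 1 one_pos)
  have hs : {w : ℂ | z.im / 2 < w.im} ∈ 𝓝 z :=
    (isOpen_lt continuous_const Complex.continuous_im).mem_nhds (by simp; linarith)
  have hb : IntegrableOn (fun t : ℝ => t * Real.exp (-(z.im / 2 * t)) * M) (Ioi 0) := by
    have h1 := integrableOn_rpow_mul_exp_neg_mul_rpow (s := 1) (p := 1) (b := z.im / 2)
      (by norm_num) one_pos (by linarith)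
    simp only [Real.rpow_one, neg_mul] at h1
    exact h1.mul_const M
  have hbound : ∀ w : ℂ, z.im / 2 < w.im → ∀ t : ℝ, 0 < t →
      ‖t * Complex.exp (Complex.I * w * t) * f t‖ ≤ t * Real.exp (-(z.im / 2 * t)) * M := by
    intro w hw t ht
    rw [norm_mul, norm_mul, norm_exp_I_mul, Complex.norm_real, Real.norm_of_nonneg ht.le]
    gcongr
    exact hM t ht
  have hm : ∀ w : ℂ, Continuous fun t : ℝ => t * Complex.exp (Complex.I * w * t) * f t :=
    fun w => by fun_prop
  refine ⟨?_, ?_⟩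
  · refine Integrable.mono' hb (hm z).aestronglyMeasurable ?_
    filter_upwards [ae_restrict_mem measurableSet_Ioi] with t ht
    exact hbound z (by linarith) t ht
  · have h := hasDerivAt_integral_of_dominated_loc_of_deriv_le (μ := volume.restrict (Ioi 0))
      (F := fun z t => Complex.exp (Complex.I * z * (t : ℝ)) * f t)
      (F' := fun z t => Complex.I * (t * Complex.exp (Complex.I * z * (t : ℝ)) * f t))
      (bound := fun t => t * Real.exp (-(z.im / 2 * t)) * M) hs
      (Eventually.of_forall fun w => ((continuous_exp_I_mul w).mul hf).aestronglyMeasurable)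
      (integrableOn_exp_mul hf hM hz) (continuous_const.mul (hm z)).aestronglyMeasurable
      ?_ hb ?_
    · refine h.2.congr_deriv ?_
      rw [integral_const_mul]
    · filter_upwards [ae_restrict_mem measurableSet_Ioi] with t ht w hw
      rw [norm_mul, Complex.norm_I, one_mul]
      exact hbound w hw t ht
    · refine ae_of_all _ fun t w _ => ?_
      have h1 : HasDerivAt (fun w : ℂ => Complex.I * w * t) (Complex.I * t) w := by
        simpa using ((hasDerivAt_id w).const_mul Complex.I).mul_const (t : ℂ)
      refine (h1.cexp.mul_const (f t)).congr_deriv ?_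
      ring

/-- If the derivative of the Laplace transform of a bounded function is integrable on horizontal
lines, uniformly near the real axis, then the function decays at least like `1 / t`. -/
theorem mul_norm_le_of_laplace {f : ℝ → ℂ} (hf : Continuous f) {M : ℝ}
    (hM : ∀ t, 0 < t → ‖f t‖ ≤ M) {L J : ℂ → ℂ} {w : ℝ → ℝ} (hw : Integrable w)
    (hL : ∀ z : ℂ, 0 < z.im → z.im < 1 →
      ∫ t in Ioi (0 : ℝ), Complex.exp (Complex.I * z * t) * f t = L z)
    (hJ : ∀ z : ℂ, 0 < z.im → z.im < 1 → HasDerivAt L (J z) z)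
    (hJw : ∀ᵐ x : ℝ, ∀ y : ℝ, 0 < y → y < 1 → ‖J (x + y * Complex.I)‖ ≤ w x)
    {t : ℝ} (ht : 0 < t) : t * ‖f t‖ ≤ (2 * Real.pi)⁻¹ * ∫ x, w x := by
  have key : ∀ y : ℝ, 0 < y → y < 1 →
      t * Real.exp (-(y * t)) * ‖f t‖ ≤ (2 * Real.pi)⁻¹ * ∫ x, w x := by
    intro y hy hy1
    -- The factor `max s 0` represents the `z`-derivative of the Laplace transform and also makes
    -- the extension by zero continuous at the origin, so that Fourier inversion holds at every
    -- point. The damping `exp (-y s)` provides integrability.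
    set h : ℝ → ℂ := fun s =>
      ((max s 0 : ℝ) : ℂ) * Complex.exp (Complex.I * (y * Complex.I) * s) * f s with hh
    have hc : Continuous h := by fun_prop
    have hind : ∀ x : ℝ, (fun s : ℝ => Complex.exp (Complex.I * x * s) * h s) = (Ioi 0).indicator
        fun s : ℝ => s * Complex.exp (Complex.I * (x + y * Complex.I) * s) * f s := fun x => by
      ext s
      by_cases hs : 0 < s
      · rw [indicator_of_mem (mem_Ioi.2 hs)]
        simp only [hh, max_eq_left hs.le, mul_add, add_mul, Complex.exp_add]
        ring
      · rw [indicator_of_notMem (by simpa using hs)]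
        simp [hh, max_eq_right (not_lt.1 hs)]
    have hz : ∀ x : ℝ, ((x : ℂ) + y * Complex.I).im = y := fun x => by simp
    have hint : Integrable h := by
      have h1 := (hasDerivAt_integral_exp_mul hf hM (z := (0 : ℝ) + y * Complex.I)
        (by rwa [hz])).1
      have h2 := hind 0
      simp only [Complex.ofReal_zero, mul_zero, zero_mul, Complex.exp_zero, one_mul] at h2
      change Integrable fun s => h s
      rw [h2, integrable_indicator_iff measurableSet_Ioi]
      exact_mod_cast h1
    have hJ' : ∀ x : ℝ, ‖∫ s : ℝ, Complex.exp (Complex.I * x * s) * h s‖ = ‖J (x + y * Complex.I)‖ := by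
      intro x
      have hzi : 0 < ((x : ℂ) + y * Complex.I).im := by rwa [hz]
      have hzi1 : ((x : ℂ) + y * Complex.I).im < 1 := by rwa [hz]
      rw [hind, integral_indicator measurableSet_Ioi]
      have h1 := (hasDerivAt_integral_exp_mul hf hM hzi).2
      have h2 : L =ᶠ[𝓝 ((x : ℂ) + y * Complex.I)]
          fun z => ∫ t in Ioi (0 : ℝ), Complex.exp (Complex.I * z * t) * f t := by
        filter_upwards [(isOpen_lt continuous_const Complex.continuous_im).mem_nhds hzi,
          (isOpen_lt Complex.continuous_im continuous_const).mem_nhds hzi1] with z h1 h2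
        exact (hL z h1 h2).symm
      rw [(hJ _ hzi hzi1).unique (h1.congr_of_eventuallyEq h2), norm_mul, Complex.norm_I, one_mul]
    have hF : ∀ ξ : ℝ, FourierTransform.fourier h ξ =
        ∫ s : ℝ, Complex.exp (Complex.I * ((-(2 * Real.pi) * ξ : ℝ) : ℂ) * s) * h s := fun ξ => by
      rw [Real.fourier_eq' h ξ]
      refine integral_congr_ae (ae_of_all _ fun s => ?_)
      simp only [smul_eq_mul, RCLike.inner_apply, conj_trivial]
      congr 2
      push_cast
      ring
    have hpi : -(2 * Real.pi) ≠ 0 := by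
      have := Real.pi_pos
      linarith
    have hFw : ∀ᵐ ξ : ℝ, ‖FourierTransform.fourier h ξ‖ ≤ w (-(2 * Real.pi) * ξ) := by
      have hq : Measure.QuasiMeasurePreserving (fun ξ : ℝ => -(2 * Real.pi) * ξ) := by
        refine ⟨by fun_prop, ?_⟩
        rw [Real.map_volume_mul_left hpi]
        exact Measure.smul_absolutelyContinuous
      filter_upwards [hq.ae hJw] with ξ hξ
      rw [hF, hJ']
      exact hξ y hy hy1
    have hwi : Integrable fun ξ : ℝ => w (-(2 * Real.pi) * ξ) := hw.comp_mul_left' hpi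
    have hFc : Continuous (FourierTransform.fourier h) :=
      VectorFourier.fourierIntegral_continuous Real.continuous_fourierChar
        (by fun_prop) hint
    have hFi : Integrable (FourierTransform.fourier h) :=
      Integrable.mono' hwi hFc.aestronglyMeasurable hFw
    have h1 := congr_fun (hc.fourierInv_fourier_eq hint hFi) t
    have h2 : ‖h t‖ = t * Real.exp (-(y * t)) * ‖f t‖ := by
      simp only [hh, norm_mul, norm_exp_I_mul, max_eq_left ht.le, Complex.norm_real,
        Real.norm_of_nonneg ht.le]
      simp
    rw [← h2, ← h1, Real.fourierInv_eq']
    calc ‖∫ v, Complex.exp (((2 * Real.pi * inner ℝ v t : ℝ) : ℂ) * Complex.I) •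
            FourierTransform.fourier h v‖
        ≤ ∫ v, w (-(2 * Real.pi) * v) := by
          refine norm_integral_le_of_norm_le hwi ?_
          filter_upwards [hFw] with v hv
          rwa [norm_smul, Complex.norm_exp_ofReal_mul_I, one_mul]
      _ = (2 * Real.pi)⁻¹ * ∫ x, w x := by
          rw [Measure.integral_comp_mul_left, inv_neg, abs_neg, abs_of_pos (by positivity),
            smul_eq_mul]
  -- The bound `key` does not depend on the height `y` of the line, so the damping can be removed.
  have hlim : Tendsto (fun y : ℝ => t * Real.exp (-(y * t)) * ‖f t‖) (𝓝[>] 0) (𝓝 (t * ‖f t‖)) := by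
    have : Continuous fun y : ℝ => t * Real.exp (-(y * t)) * ‖f t‖ := by fun_prop
    simpa using (this.tendsto 0).mono_left nhdsWithin_le_nhds
  refine le_of_tendsto hlim ?_
  filter_upwards [Ioo_mem_nhdsGT one_pos] with y hy
  exact key y hy.1 hy.2

/-! ### The resolvent of the Hamiltonian -/

/-- The Stieltjes transform of `G`. -/
def stieltjes (z : ℂ) : ℂ := ∫ k in Ioi (0 : ℝ), (G k : ℂ) / (k - z)

lemma sub_ne_zero_of_im_pos {z : ℂ} (hz : 0 < z.im) (k : ℝ) : (k : ℂ) - z ≠ 0 := fun h => by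
  have := congrArg Complex.im h
  simp at this
  exact hz.ne' this

lemma im_le_norm_sub {z : ℂ} (k : ℝ) : z.im ≤ ‖(k : ℂ) - z‖ := by
  have := Complex.abs_im_le_norm ((k : ℂ) - z)
  simp only [Complex.sub_im, Complex.ofReal_im, zero_sub, abs_neg] at this
  exact (le_abs_self _).trans this

lemma memLp_g_div {z : ℂ} (hz : 0 < z.im) :
    MemLp (fun k : ℝ => (g k : ℂ) / (k - z)) 2 energyMeasure := by
  refine memLp_g.of_le_mul (c := z.im⁻¹) ?_ (ae_of_all _ fun k => ?_)
  · have : Measurable fun k : ℝ => (g k : ℂ) / (k - z) := by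
      unfold g
      fun_prop
    exact this.aestronglyMeasurable
  · rw [norm_div, div_eq_inv_mul]
    gcongr
    exact im_le_norm_sub k

/-- The Laplace transform of the return amplitude. -/
theorem integral_exp_mul_returnAmplitude {E₀ β : ℝ} {z : ℂ} (hz : 0 < z.im)
    (hD : (E₀ : ℂ) - z - β ^ 2 * stieltjes z ≠ 0) :
    ∫ t in Ioi (0 : ℝ), Complex.exp (Complex.I * z * t) * returnAmplitude E₀ β t =
      -(Complex.I * ((E₀ : ℂ) - z - β ^ 2 * stieltjes z)⁻¹) := by
  set w := ((E₀ : ℂ) - z - β ^ 2 * stieltjes z)⁻¹ with hw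
  set φ : Photon := (memLp_g_div hz).toLp _ with hφ
  have hφae : φ =ᵐ[energyMeasure] fun k : ℝ => (g k : ℂ) / (k - z) := (memLp_g_div hz).coeFn_toLp
  have hgae : gVec =ᵐ[energyMeasure] fun k : ℝ => (g k : ℂ) := memLp_g.coeFn_toLp
  have hin : inner ℂ gVec φ = stieltjes z := by
    rw [L2.inner_def, stieltjes]
    refine integral_congr_ae ?_
    filter_upwards [hφae, hgae] with k h1 h2
    rw [h1, h2, RCLike.inner_apply, Complex.conj_ofReal, G]
    push_cast
    ring
  -- This is the solution of `(H - z) x = Φ₁`. The photon component `-β w g / (k - z)` is forced by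
  -- the second equation, and the first then reads `(E₀ - z - β² S(z)) w = 1`.
  set x : Space := WithLp.toLp 2 (w, (-(β * w) : ℂ) • φ) with hx
  have hgr : (x, excited + z • x) ∈ (hamiltonian E₀ β).graph := by
    rw [mem_graph_hamiltonian_iff]
    have e1 : (excited + z • x).fst = 1 + z * w := rfl
    have e2 : (excited + z • x).snd = 0 + z • (-(β * w) : ℂ) • φ := rfl
    have e3 : x.fst = w := rfl
    have e4 : x.snd = (-(β * w) : ℂ) • φ := rfl
    rw [e1, e2, e3, e4, zero_add, smul_smul]
    refine ⟨?_, ?_⟩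
    · rw [inner_smul_right, hin]
      have : ((E₀ : ℂ) - z - β ^ 2 * stieltjes z) * w = 1 := mul_inv_cancel₀ hD
      linear_combination -this
    · filter_upwards [hφae, hgae, Lp.coeFn_sub ((z * (-(β * w)) : ℂ) • φ) ((β * w : ℂ) • gVec),
        Lp.coeFn_smul (z * (-(β * w)) : ℂ) φ, Lp.coeFn_smul (β * w : ℂ) gVec,
        Lp.coeFn_smul (-(β * w) : ℂ) φ] with k h1 h2 h3 h4 h5 h6
      rw [h3, Pi.sub_apply, h4, h5, h6, Pi.smul_apply, Pi.smul_apply, Pi.smul_apply, h1, h2]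
      simp only [smul_eq_mul]
      have := sub_ne_zero_of_im_pos hz k
      field_simp
      ring
  have h := (isUnitaryGroup_unitaryGroup E₀ β).integral_exp_mul_inner hz hgr excited
  rw [inner_excited] at h
  exact h

lemma continuous_returnAmplitude (E₀ β : ℝ) : Continuous (returnAmplitude E₀ β) :=
  continuous_const.inner ((isUnitaryGroup_unitaryGroup E₀ β).continuous _)

lemma norm_returnAmplitude_le (E₀ β t : ℝ) : ‖returnAmplitude E₀ β t‖ ≤ 1 := by
  have h1 : ‖excited‖ = 1 := by
    refine (sq_eq_sq₀ (norm_nonneg _) zero_le_one).1 ?_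
    rw [WithLp.prod_norm_sq_eq_of_L2]
    simp [excited]
  exact ((isUnitaryGroup_unitaryGroup E₀ β).norm_inner_le excited excited t).trans_eq
    (by rw [h1, one_mul])

/-! ### Closed forms of the Stieltjes transform and of the principal value -/

/-- The function `z ^ p / (z² + a²) ^ q`. -/
def ratio {K : Type*} [Field K] (p q : ℕ) (z : K) : K := z ^ p * ((z ^ 2 + 9 / 4)⁻¹) ^ q

/-- The exponents of `k` in the moments. -/
def kExp : Fin 7 → ℕ := ![0, 0, 0, 0, 1, 1, 1]

/-- The exponents of `(k² + a²)⁻¹` in the moments. -/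
def uExp : Fin 7 → ℕ := ![1, 2, 3, 4, 2, 3, 4]

/-- The exponents of `z` in the Stieltjes transform. -/
def zExp : Fin 7 → ℕ := ![2, 2, 2, 2, 1, 1, 1]

/-- The exponents of `(z² + a²)⁻¹` in the Stieltjes transform. -/
def vExp : Fin 7 → ℕ := ![4, 3, 2, 1, 3, 2, 1]

/-- The integral of `k ^ p / (k² + a²) ^ q` over the half-line. -/
def moment (p q : ℕ) : ℝ := ∫ k in Ioi (0 : ℝ), ratio p q k

/-- The part of the integrand of the Stieltjes transform without singularity at `k = z`. -/
def regularIntegrand {K : Type*} [Field K] (z k : K) : K :=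
  ratio 0 4 k - ∑ i, ratio (zExp i) (vExp i) z * ratio (kExp i) (uExp i) k

/-- The contribution of `regularIntegrand` to the Stieltjes transform. -/
def regularPart (z : ℂ) : ℂ :=
  moment 0 4 - ∑ i, ratio (zExp i) (vExp i) z * moment (kExp i) (uExp i)

/-- The continuation of the Stieltjes transform of `G` from the upper half-plane to the plane cut
along the negative imaginary axis. -/
def stieltjesCont (z : ℂ) : ℂ :=
  ratio 1 4 z * (Real.log (3 / 2) + Real.pi / 2 * Complex.I - Complex.log (-Complex.I * z)) +
    regularPart z

lemma ofReal_ratio (p q : ℕ) (x : ℝ) : ((ratio p q x : ℝ) : ℂ) = ratio p q (x : ℂ) := by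
  simp [ratio]

lemma ofReal_regularIntegrand (x k : ℝ) :
    ((regularIntegrand x k : ℝ) : ℂ) = regularIntegrand (x : ℂ) (k : ℂ) := by
  simp [regularIntegrand, ofReal_ratio]

/-- The partial fraction decomposition of `k (k² + a²)⁻⁴ (k - z)⁻¹`. -/
lemma partial_fractions {K : Type*} [Field K] {k z : K} [CharZero K] (hu : k ^ 2 + 9 / 4 ≠ 0)
    (hv : z ^ 2 + 9 / 4 ≠ 0) (hkz : k - z ≠ 0) :
    ratio 1 4 k / (k - z) =
      ratio 1 4 z * ((k - z)⁻¹ - k / (k ^ 2 + 9 / 4)) + regularIntegrand z k := by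
  simp only [regularIntegrand, ratio, Fin.sum_univ_succ, Fin.sum_univ_zero, zExp, vExp, kExp, uExp,
    Matrix.cons_val_zero, Matrix.cons_val_succ]
  generalize hU : k ^ 2 + 9 / 4 = u at *
  generalize hV : z ^ 2 + 9 / 4 = v at *
  -- Because of this factorization, `(u⁻⁴ - v⁻⁴) / (k - z)` is `-(k + z)` times the sum of `u⁻ʲ
  -- v^(j-5)` for `j = 1, ..., 4`. Of the eight resulting terms only `k / u` is not integrable; it
  -- is paired with `(k - z)⁻¹`, which leaves seven.
  have hd : u - v = (k - z) * (k + z) := by rw [← hU, ← hV]; ring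
  have hu4 : v = u - (k - z) * (k + z) := by rw [← hd]; ring
  field_simp
  rw [hu4]
  ring

lemma G_eq_ratio {k : ℝ} (hk : 0 < k) : G k = ratio 1 4 k := by
  rw [G, g, mul_pow, Real.sq_sqrt hk.le, a_sq, inv_pow, ← pow_mul, ratio, pow_one, inv_pow]

lemma G_pos {k : ℝ} (hk : 0 < k) : 0 < G k := by
  rw [G_eq_ratio hk, ratio]
  positivity

/-- The hypothesis keeps `z` quantitatively away from the poles `± 3i/2`. It holds on the real line
and in the strip `|Im z| ≤ 1`, so one estimate serves both the moments and the bounds on the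
Stieltjes transform. -/
lemma norm_ratio_le {z : ℂ} (hz : 1 + ‖z‖ ^ 2 ≤ 8 * ‖z ^ 2 + 9 / 4‖) {p q : ℕ} (hpq : p ≤ 2 * q) :
    ‖ratio p q z‖ ≤ 8 ^ q := by
  have h0 : 0 < ‖z ^ 2 + 9 / 4‖ := by nlinarith [sq_nonneg ‖z‖]
  have h1 : ‖z‖ ^ p ≤ (1 + ‖z‖ ^ 2) ^ q := by
    have h2 : ‖z‖ ^ p ≤ (max 1 ‖z‖) ^ (2 * q) :=
      (pow_le_pow_left₀ (norm_nonneg z) (le_max_right 1 _) p).trans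
        (pow_le_pow_right₀ (le_max_left _ _) hpq)
    refine h2.trans ?_
    rw [pow_mul]
    gcongr
    rcases max_cases 1 ‖z‖ with h | h <;> rw [h.1] <;> nlinarith [sq_nonneg ‖z‖]
  rw [ratio, norm_mul, norm_pow, norm_pow, norm_inv, inv_pow, ← div_eq_mul_inv,
    div_le_iff₀ (by positivity), ← mul_pow]
  exact h1.trans (by gcongr)

lemma one_add_sq_le_real (k : ℝ) : 1 + ‖(k : ℂ)‖ ^ 2 ≤ 8 * ‖(k : ℂ) ^ 2 + 9 / 4‖ := by
  have h : ((k : ℂ) ^ 2 + 9 / 4) = ((k ^ 2 + 9 / 4 : ℝ) : ℂ) := by push_cast; rfl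
  rw [h, Complex.norm_real, Complex.norm_real, Real.norm_eq_abs, sq_abs,
    Real.norm_of_nonneg (show 0 ≤ k ^ 2 + 9 / 4 by positivity)]
  nlinarith [sq_nonneg k]

lemma continuous_ratio (p q : ℕ) : Continuous fun k : ℝ => ratio p q k := by
  unfold ratio
  exact (continuous_pow p).mul ((Continuous.inv₀ (by fun_prop) fun k => by positivity).pow q)

lemma integrableOn_ratio {p q : ℕ} (hpq : p + 2 ≤ 2 * q) (s : Set ℝ) :
    IntegrableOn (fun k : ℝ => ratio p q k) s := by
  refine (Integrable.mono' (integrable_inv_one_add_sq.const_mul (8 ^ (q - 1)))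
    (continuous_ratio p q).aestronglyMeasurable (ae_of_all _ fun k => ?_)).integrableOn
  obtain ⟨q, rfl⟩ : ∃ r, q = r + 1 := ⟨q - 1, by omega⟩
  have h : ratio p (q + 1) k = ratio p q k * (k ^ 2 + 9 / 4)⁻¹ := by
    rw [ratio, ratio, pow_succ, mul_assoc]
  have h1 : ‖ratio p q k‖ ≤ 8 ^ q := by
    have := norm_ratio_le (one_add_sq_le_real k) (p := p) (q := q) (by omega)
    rwa [← ofReal_ratio, Complex.norm_real] at this
  rw [h, norm_mul, Nat.add_sub_cancel]
  gcongr
  rw [Real.norm_of_nonneg (by positivity)]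
  exact inv_anti₀ (by positivity) (by linarith)

lemma kExp_le (i : Fin 7) : kExp i + 2 ≤ 2 * uExp i := by
  revert i
  decide

lemma zExp_le (i : Fin 7) : zExp i ≤ 2 * vExp i := by
  revert i
  decide

lemma integrableOn_regularIntegrand (z : ℂ) (s : Set ℝ) :
    IntegrableOn (fun k : ℝ => regularIntegrand z k) s := by
  simp only [regularIntegrand, ← ofReal_ratio _ _ (_ : ℝ)]
  exact (integrableOn_ratio (by norm_num) s).ofReal.sub (integrable_finsetSum _ fun i _ =>
    ((integrableOn_ratio (kExp_le i) s).ofReal.const_mul _))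

lemma integral_regularIntegrand (z : ℂ) :
    ∫ k in Ioi (0 : ℝ), regularIntegrand z (k : ℂ) = regularPart z := by
  simp only [regularIntegrand, ← ofReal_ratio _ _ (_ : ℝ)]
  rw [integral_sub (integrableOn_ratio (by norm_num) _).ofReal (integrable_finsetSum _ fun i _ =>
    ((integrableOn_ratio (kExp_le i) _).ofReal.const_mul _)), integral_finsetSum _ fun i _ =>
    ((integrableOn_ratio (kExp_le i) _).ofReal.const_mul _)]
  simp only [integral_const_mul, integral_complex_ofReal]
  rfl

/-- The two logarithms have the same leading growth. This is what makes the primitive of `(k - z)⁻¹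
- k / (k² + a²)` converge at infinity, for complex `z` as well as for the principal value. -/
lemma tendsto_log_sub_half_log :
    Tendsto (fun k : ℝ => Real.log k - Real.log (k ^ 2 + 9 / 4) / 2) atTop (𝓝 0) := by
  have h1 : Tendsto (fun k : ℝ => -(Real.log (1 + 9 / 4 * (k ^ 2)⁻¹) / 2)) atTop (𝓝 0) := by
    have h2 : Tendsto (fun k : ℝ => 1 + 9 / 4 * (k ^ 2)⁻¹) atTop (𝓝 (1 + 9 / 4 * 0)) :=
      ((tendsto_pow_atTop two_ne_zero).inv_tendsto_atTop.const_mul _).const_add _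
    rw [mul_zero, add_zero] at h2
    have h3 := ((Real.continuousAt_log one_ne_zero).tendsto.comp h2).div_const 2 |>.neg
    simpa using h3
  refine h1.congr' ?_
  filter_upwards [eventually_gt_atTop 0] with k hk
  have h4 : k ^ 2 + 9 / 4 = k ^ 2 * (1 + 9 / 4 * (k ^ 2)⁻¹) := by
    field_simp
  rw [h4, Real.log_mul (by positivity) (by positivity), Real.log_pow]
  push_cast
  ring

lemma hasDerivAt_half_log (k : ℝ) :
    HasDerivAt (fun k : ℝ => Real.log (k ^ 2 + 9 / 4) / 2) (k / (k ^ 2 + 9 / 4)) k := by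
  have h1 : HasDerivAt (fun k : ℝ => k ^ 2 + 9 / 4) (2 * k) k := by
    simpa using (hasDerivAt_pow 2 k).add_const (9 / 4)
  refine ((h1.log (by positivity)).div_const 2).congr_deriv ?_
  field_simp

lemma half_log_zero : Real.log ((0 : ℝ) ^ 2 + 9 / 4) / 2 = Real.log (3 / 2) := by
  rw [show ((0 : ℝ) ^ 2 + 9 / 4) = (3 / 2) ^ 2 by norm_num, Real.log_pow]
  push_cast
  ring

/-- The Stieltjes transform of `G` in the upper half-plane. -/
theorem stieltjes_eq {z : ℂ} (hz : 0 < z.im) (hv : z ^ 2 + 9 / 4 ≠ 0) :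
    stieltjes z = stieltjesCont z := by
  -- Multiplication by `i` turns `k - z` into the right half-plane, where the principal logarithm is
  -- analytic. The value at `k = 0` is then `log (-i z)`, and the limit at infinity leaves `iπ/2`.
  have hre : ∀ k : ℝ, 0 < (Complex.I * (k - z)).re := fun k => by simpa using hz
  have hd : ∀ k : ℝ, HasDerivAt (fun k : ℝ => Complex.log (Complex.I * (k - z)) -
      ((Real.log (k ^ 2 + 9 / 4) / 2 : ℝ) : ℂ)) (((k : ℂ) - z)⁻¹ - k / (k ^ 2 + 9 / 4)) k := by
    intro k
    have h1 : HasDerivAt (fun k : ℝ => Complex.I * ((k : ℂ) - z)) Complex.I k := by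
      simpa using ((hasDerivAt_id k).ofReal_comp.sub_const z).const_mul Complex.I
    have h2 := (h1.clog_real (Or.inl (hre k))).sub (hasDerivAt_half_log k).ofReal_comp
    refine h2.congr_deriv ?_
    have := sub_ne_zero_of_im_pos hz k
    push_cast
    field_simp
  have hlim : Tendsto (fun k : ℝ => Complex.log (Complex.I * (k - z)) -
      ((Real.log (k ^ 2 + 9 / 4) / 2 : ℝ) : ℂ)) atTop (𝓝 (Real.pi / 2 * Complex.I)) := by
    have h1 : Tendsto (fun k : ℝ => Complex.I * (1 - z * ((k⁻¹ : ℝ) : ℂ))) atTop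
        (𝓝 (Complex.I * (1 - z * ((0 : ℝ) : ℂ)))) :=
      (((Complex.continuous_ofReal.tendsto 0).comp tendsto_inv_atTop_zero).const_mul z
        |>.const_sub 1).const_mul Complex.I
    rw [Complex.ofReal_zero, mul_zero, sub_zero, mul_one] at h1
    have h2 := (continuousAt_clog (Or.inr (by simp : Complex.I.im ≠ 0))).tendsto.comp h1
    rw [Complex.log_I] at h2
    have h3 := h2.add ((Complex.continuous_ofReal.tendsto 0).comp tendsto_log_sub_half_log)
    rw [Complex.ofReal_zero, add_zero] at h3
    refine h3.congr' ?_
    filter_upwards [eventually_gt_atTop 0] with k hk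
    have hk' : (k : ℂ) ≠ 0 := Complex.ofReal_ne_zero.2 hk.ne'
    have h4 : Complex.I * (k - z) = k * (Complex.I * (1 - z * ((k⁻¹ : ℝ) : ℂ))) := by
      push_cast
      field_simp
    have h5 : Complex.I * (1 - z * ((k⁻¹ : ℝ) : ℂ)) ≠ 0 := by
      intro h
      rw [h, mul_zero] at h4
      have := hre k
      rw [h4] at this
      simp at this
    rw [h4, Complex.log_ofReal_mul hk h5]
    simp only [Function.comp]
    push_cast
    ring
  have hint : IntegrableOn (fun k : ℝ => ((k : ℂ) - z)⁻¹ - k / (k ^ 2 + 9 / 4)) (Ioi 0) := by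
    have hc : Continuous fun k : ℝ => ((k : ℂ) - z)⁻¹ - k / (k ^ 2 + 9 / 4) := by
      refine Continuous.sub (Continuous.inv₀ (by fun_prop) (sub_ne_zero_of_im_pos hz))
        (Continuous.div (by fun_prop) (by fun_prop) fun k => ?_)
      have : ((k : ℂ) ^ 2 + 9 / 4) = ((k ^ 2 + 9 / 4 : ℝ) : ℂ) := by push_cast; rfl
      rw [this, Complex.ofReal_ne_zero]
      positivity
    refine (Integrable.mono' (integrable_inv_one_add_sq.const_mul
      (9 / 4 * z.im⁻¹ + ‖z‖ * (1 + ‖z‖ * z.im⁻¹))) hc.aestronglyMeasurable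
      (ae_of_all _ fun k => ?_)).integrableOn
    have hkz := sub_ne_zero_of_im_pos hz k
    have hcast : ((k : ℂ) ^ 2 + 9 / 4) = ((k ^ 2 + 9 / 4 : ℝ) : ℂ) := by push_cast; rfl
    have hku : ((k : ℂ) ^ 2 + 9 / 4) ≠ 0 := by
      rw [hcast, Complex.ofReal_ne_zero]
      positivity
    -- The sum of the two fractions shows the decay `k⁻²`, after `k / (k - z)` is written as `1 + z
    -- / (k - z)`.
    have e : ((k : ℂ) - z)⁻¹ - k / (k ^ 2 + 9 / 4) =
        (9 / 4 * ((k : ℂ) - z)⁻¹ + z * (1 + z * ((k : ℂ) - z)⁻¹)) *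
          ((k ^ 2 + 9 / 4 : ℝ) : ℂ)⁻¹ := by
      rw [← hcast, eq_mul_inv_iff_mul_eq₀ hku, sub_mul, div_mul_cancel₀ _ hku]
      field_simp
      ring
    have hn : ‖((k : ℂ) - z)⁻¹‖ ≤ z.im⁻¹ := by
      rw [norm_inv]
      gcongr
      exact im_le_norm_sub k
    rw [e, norm_mul]
    gcongr
    · refine (norm_add_le _ _).trans ?_
      rw [norm_mul, norm_mul]
      gcongr
      · norm_num
      · refine (norm_add_le _ _).trans ?_
        rw [norm_one, norm_mul]
        gcongr
    · rw [norm_inv, Complex.norm_real, Real.norm_of_nonneg (by positivity)]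
      exact inv_anti₀ (by positivity) (by linarith)
  have hval := integral_Ioi_of_hasDerivAt_of_tendsto' (fun k _ => hd k) hint hlim
  have hsplit : stieltjes z = ∫ k in Ioi (0 : ℝ), (ratio 1 4 z *
      (((k : ℂ) - z)⁻¹ - k / (k ^ 2 + 9 / 4)) + regularIntegrand z (k : ℂ)) := by
    refine setIntegral_congr_fun measurableSet_Ioi fun k hk => ?_
    have hcast : ((k : ℂ) ^ 2 + 9 / 4) = ((k ^ 2 + 9 / 4 : ℝ) : ℂ) := by push_cast; rfl
    simp only [G_eq_ratio hk, ofReal_ratio]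
    refine partial_fractions ?_ hv (sub_ne_zero_of_im_pos hz k)
    rw [hcast, Complex.ofReal_ne_zero]
    positivity
  rw [hsplit, integral_add (hint.const_mul _) (integrableOn_regularIntegrand z _),
    integral_const_mul, hval, integral_regularIntegrand, stieltjesCont, half_log_zero,
    Complex.ofReal_zero, zero_sub, mul_neg, neg_mul]
  ring

lemma log_neg_I_mul {x : ℝ} (hx : 0 < x) :
    Complex.log (-Complex.I * x) = Real.log x - Real.pi / 2 * Complex.I := by
  rw [mul_comm, Complex.log_ofReal_mul hx (neg_ne_zero.2 Complex.I_ne_zero), Complex.log_neg_I]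
  ring

/-- The principal value integral exists. -/
theorem tendsto_truncatedIntegral {x : ℝ} (hx : 0 < x) :
    Tendsto (truncatedIntegral x) (𝓝[>] 0) (𝓝 (stieltjesCont x).re) := by
  have hset : ∀ ε, 0 < ε → ε < x →
      {k : ℝ | 0 < k ∧ ε < |k - x|} = Ioo 0 (x - ε) ∪ Ioi (x + ε) := by
    intro ε hε hεx
    ext k
    simp only [mem_ofPred_eq, mem_union, mem_Ioo, mem_Ioi, lt_abs]
    constructor
    · rintro ⟨h1, h2 | h2⟩
      · exact Or.inr (by linarith)
      · exact Or.inl ⟨h1, by linarith⟩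
    · rintro (⟨h1, h2⟩ | h1)
      · exact ⟨h1, Or.inr (by linarith)⟩
      · exact ⟨by linarith, Or.inl (by linarith)⟩
  set Φ : ℝ → ℝ := fun k => Real.log (k - x) - Real.log (k ^ 2 + 9 / 4) / 2 with hΦ
  set φ : ℝ → ℝ := fun k => (k - x)⁻¹ - k / (k ^ 2 + 9 / 4) with hφ
  have hd : ∀ k, k ≠ x → HasDerivAt Φ (φ k) k := fun k hk => by
    refine ((((hasDerivAt_id k).sub_const x).log (sub_ne_zero.2 hk)).sub
      (hasDerivAt_half_log k)).congr_deriv ?_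
    simp [hφ]
  have hφc : ∀ k, k ≠ x → ContinuousAt φ k := fun k hk => by
    refine ContinuousAt.sub (ContinuousAt.inv₀ (by fun_prop) (sub_ne_zero.2 hk))
      (ContinuousAt.div (by fun_prop) (by fun_prop) (by positivity))
  have hlim : Tendsto Φ atTop (𝓝 0) := by
    have h1 : Tendsto (fun k : ℝ => Real.log (1 - x * k⁻¹)) atTop (𝓝 0) := by
      have h2 : Tendsto (fun k : ℝ => 1 - x * k⁻¹) atTop (𝓝 (1 - x * 0)) :=
        (tendsto_inv_atTop_zero.const_mul x).const_sub 1
      rw [mul_zero, sub_zero] at h2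
      simpa [Function.comp_def] using (Real.continuousAt_log one_ne_zero).tendsto.comp h2
    have h3 := h1.add tendsto_log_sub_half_log
    rw [add_zero] at h3
    refine h3.congr' ?_
    filter_upwards [eventually_gt_atTop x] with k hk
    have hk0 : 0 < k := hx.trans hk
    have h4 : k - x = k * (1 - x * k⁻¹) := by field_simp
    have h5 : 1 - x * k⁻¹ ≠ 0 := by
      intro h
      rw [h, mul_zero] at h4
      linarith
    simp only [hΦ]
    rw [h4, Real.log_mul hk0.ne' h5]
    ring
  have hsing : ∀ ε, 0 < ε → ε < x →
      IntegrableOn φ {k : ℝ | 0 < k ∧ ε < |k - x|} ∧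
      ∫ k in {k : ℝ | 0 < k ∧ ε < |k - x|}, φ k = Real.log (3 / 2) - Real.log x +
        (Real.log ((x + ε) ^ 2 + 9 / 4) / 2 - Real.log ((x - ε) ^ 2 + 9 / 4) / 2) := by
    intro ε hε hεx
    have hne1 : ∀ k ∈ Icc 0 (x - ε), k ≠ x := fun k hk h => by
      rw [h] at hk
      linarith [hk.2]
    have hne2 : ∀ k ∈ Ici (x + ε), k ≠ x := fun k hk h => by
      have : x + ε ≤ k := hk
      linarith
    have hi1 : IntegrableOn φ (Icc 0 (x - ε)) :=
      ContinuousOn.integrableOn_Icc fun k hk => (hφc k (hne1 k hk)).continuousWithinAt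
    have hi2 : IntegrableOn φ (Ioi (x + ε)) := by
      refine integrableOn_Ioi_deriv_of_nonneg' (g := Φ) (fun k hk => hd k (hne2 k hk))
        (fun k hk => ?_) hlim
      have hk' : x + ε < k := hk
      have h1 : 0 < k - x := by linarith
      have h2 : φ k = (9 / 4 + k * x) / ((k - x) * (k ^ 2 + 9 / 4)) := by
        simp only [hφ]
        field_simp
        ring
      rw [h2]
      have : 0 < k := by linarith
      positivity
    have hv1 : ∫ k in Ioo 0 (x - ε), φ k = Φ (x - ε) - Φ 0 := by
      rw [← integral_Ioc_eq_integral_Ioo, ← intervalIntegral.integral_of_le (by linarith)]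
      refine intervalIntegral.integral_eq_sub_of_hasDerivAt (fun k hk => ?_) ?_
      · rw [uIcc_of_le (by linarith)] at hk
        exact hd k (hne1 k hk)
      · rw [intervalIntegrable_iff_integrableOn_Icc_of_le (by linarith)]
        exact hi1
    have hv2 : ∫ k in Ioi (x + ε), φ k = 0 - Φ (x + ε) :=
      integral_Ioi_of_hasDerivAt_of_tendsto' (fun k hk => hd k (hne2 k hk)) hi2 hlim
    have hdisj : Disjoint (Ioo 0 (x - ε)) (Ioi (x + ε)) := by
      rw [Set.disjoint_left]
      intro k h1 h2
      have h2' : x + ε < k := h2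
      linarith [h1.2]
    rw [hset ε hε hεx]
    refine ⟨(hi1.mono_set Ioo_subset_Icc_self).union hi2, ?_⟩
    rw [setIntegral_union hdisj measurableSet_Ioi (hi1.mono_set Ioo_subset_Icc_self) hi2, hv1, hv2]
    simp only [hΦ, half_log_zero]
    -- `Real.log` takes the logarithm of the absolute value, so `Φ` is a primitive on both sides of
    -- `x`. The two endpoints `x ± ε` contribute `log ε` with opposite signs, and the divergence
    -- cancels.
    rw [sub_sub_cancel_left, zero_sub, Real.log_neg_eq_log, Real.log_neg_eq_log,
      add_sub_cancel_left]
    ring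
  have hreg : IntegrableOn (fun k : ℝ => regularIntegrand x k) (Ioi 0) := by
    have := (integrableOn_regularIntegrand (x : ℂ) (Ioi 0)).re
    refine this.congr (ae_of_all _ fun k => ?_)
    simp only [← ofReal_regularIntegrand]
    exact Complex.ofReal_re _
  have hregv : ((∫ k in Ioi (0 : ℝ), regularIntegrand x k : ℝ) : ℂ) = regularPart x := by
    rw [← integral_regularIntegrand, ← integral_complex_ofReal]
    simp only [ofReal_regularIntegrand]
  have hmeas : ∀ ε : ℝ, MeasurableSet {k : ℝ | ε < |k - x|} := fun ε =>
    measurableSet_lt measurable_const (by fun_prop)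
  have hregt : Tendsto (fun ε => ∫ k in {k : ℝ | 0 < k ∧ ε < |k - x|}, regularIntegrand x k)
      (𝓝[>] 0) (𝓝 (∫ k in Ioi (0 : ℝ), regularIntegrand x k)) := by
    have h1 : ∀ ε : ℝ, ∫ k in {k : ℝ | 0 < k ∧ ε < |k - x|}, regularIntegrand x k =
        ∫ k in Ioi (0 : ℝ), {k : ℝ | ε < |k - x|}.indicator (fun k => regularIntegrand x k) k := by
      intro ε
      rw [setIntegral_indicator (hmeas ε)]
      rfl
    simp only [h1]
    refine tendsto_integral_filter_of_dominated_convergence (fun k => ‖regularIntegrand x k‖)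
      (Eventually.of_forall fun ε => hreg.aestronglyMeasurable.indicator (hmeas ε))
      (Eventually.of_forall fun ε => ae_of_all _ fun k => norm_indicator_le_norm_self _ _)
      hreg.norm ?_
    have hne : ∀ᵐ k ∂(volume.restrict (Ioi (0 : ℝ))), k ≠ x :=
      ae_restrict_of_ae (Measure.ae_ne volume x)
    filter_upwards [hne] with k hk
    refine tendsto_const_nhds.congr' ?_
    filter_upwards [Ioo_mem_nhdsGT (abs_pos.2 (sub_ne_zero.2 hk))] with ε hε
    exact (indicator_of_mem (s := {k : ℝ | ε < |k - x|}) hε.2 _).symm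
  have hsingt : Tendsto (fun ε : ℝ => ratio 1 4 x * (Real.log (3 / 2) - Real.log x +
        (Real.log ((x + ε) ^ 2 + 9 / 4) / 2 - Real.log ((x - ε) ^ 2 + 9 / 4) / 2))) (𝓝[>] 0)
      (𝓝 (ratio 1 4 x * (Real.log (3 / 2) - Real.log x))) := by
    have hc : Continuous fun ε : ℝ => ratio 1 4 x * (Real.log (3 / 2) - Real.log x +
        (Real.log ((x + ε) ^ 2 + 9 / 4) / 2 - Real.log ((x - ε) ^ 2 + 9 / 4) / 2)) := by
      refine continuous_const.mul (continuous_const.add (Continuous.sub ?_ ?_)) <;>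
        exact (Continuous.log (by fun_prop) fun ε => by positivity).div_const 2
    have := hc.tendsto 0
    simp only [add_zero, sub_zero, sub_self] at this
    exact this.mono_left nhdsWithin_le_nhds
  have hre : (stieltjesCont x).re = ratio 1 4 x * (Real.log (3 / 2) - Real.log x) +
      ∫ k in Ioi (0 : ℝ), regularIntegrand x k := by
    rw [stieltjesCont, ← hregv, ← ofReal_ratio, log_neg_I_mul hx, Complex.add_re,
      Complex.re_ofReal_mul, Complex.ofReal_re]
    simp
  rw [hre]
  refine (hsingt.add hregt).congr' ?_
  filter_upwards [Ioo_mem_nhdsGT hx] with ε hε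
  obtain ⟨h1, h2⟩ := hsing ε hε.1 hε.2
  have hm : MeasurableSet {k : ℝ | 0 < k ∧ ε < |k - x|} := measurableSet_Ioi.inter (hmeas ε)
  rw [← h2, ← integral_const_mul, ← integral_add (h1.const_mul _)
    (hreg.mono_set fun k hk => hk.1), truncatedIntegral]
  refine setIntegral_congr_fun hm fun k hk => ?_
  have hkx : k - x ≠ 0 := fun h => by
    have := hk.2
    rw [h, abs_zero] at this
    linarith [hε.1]
  simp only [G_eq_ratio hk.1, hφ]
  exact (partial_fractions (by positivity) (by positivity) hkx).symm

lemma F_eq {x : ℝ} (hx : 0 < x) : F x = (stieltjesCont x).re :=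
  (tendsto_truncatedIntegral hx).limUnder_eq

/-- The constant `iπ/2` and the argument `-π/2` of `-i x` add up to `iπ` in the logarithmic factor;
everything else is real. The positive sign is what sends the resonance below the real axis. -/
lemma stieltjesCont_im {x : ℝ} (hx : 0 < x) : (stieltjesCont x).im = Real.pi * G x := by
  have h : (regularPart x).im = 0 := by
    have : regularPart x = ((moment 0 4 -
        ∑ i, ratio (zExp i) (vExp i) x * moment (kExp i) (uExp i) : ℝ) : ℂ) := by
      simp [regularPart, ofReal_ratio]
    rw [this, Complex.ofReal_im]
  rw [stieltjesCont, Complex.add_im, h, ← ofReal_ratio, log_neg_I_mul hx, Complex.im_ofReal_mul,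
    G_eq_ratio hx]
  simp
  ring

/-! ### Bounds on the Stieltjes transform -/

/-- The derivative of `ratio p q`. -/
def ratioDeriv (p q : ℕ) (z : ℂ) : ℂ := p * ratio (p - 1) q z - 2 * q * ratio (p + 1) (q + 1) z

lemma hasDerivAt_ratio (p q : ℕ) {z : ℂ} (hz : z ^ 2 + 9 / 4 ≠ 0) :
    HasDerivAt (ratio p q) (ratioDeriv p q z) z := by
  have h1 : HasDerivAt (fun z : ℂ => z ^ 2 + 9 / 4) (2 * z) z := by
    simpa using (hasDerivAt_pow 2 z).add_const (9 / 4 : ℂ)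
  refine ((hasDerivAt_pow p z).fun_mul ((h1.fun_inv hz).fun_pow q)).congr_deriv ?_
  simp only [ratioDeriv, ratio, div_eq_mul_inv, ← inv_pow]
  generalize (z ^ 2 + 9 * 4⁻¹)⁻¹ = v
  rcases q with _ | q
  · simp
  · simp only [Nat.add_sub_cancel]
    push_cast
    ring

/-- The logarithmic factor of the Stieltjes transform. -/
def logFactor (z : ℂ) : ℂ :=
  Real.log (3 / 2) + Real.pi / 2 * Complex.I - Complex.log (-Complex.I * z)

lemma stieltjesCont_eq (z : ℂ) :
    stieltjesCont z = ratio 1 4 z * logFactor z + regularPart z := rfl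

/-- The derivative of `stieltjesCont`. -/
def stieltjesDeriv (z : ℂ) : ℂ :=
  ratioDeriv 1 4 z * logFactor z - ratio 0 4 z -
    ∑ i, ratioDeriv (zExp i) (vExp i) z * moment (kExp i) (uExp i)

lemma hasDerivAt_stieltjesCont {z : ℂ} (hz : -Complex.I * z ∈ Complex.slitPlane)
    (hv : z ^ 2 + 9 / 4 ≠ 0) : HasDerivAt stieltjesCont (stieltjesDeriv z) z := by
  have hz0 : z ≠ 0 := by
    rintro rfl
    simp at hz
  have h1 : HasDerivAt logFactor (-z⁻¹) z := by
    have h2 : HasDerivAt (fun z : ℂ => -Complex.I * z) (-Complex.I) z := by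
      simpa using (hasDerivAt_id z).const_mul (-Complex.I)
    refine ((h2.clog hz).const_sub
      ((Real.log (3 / 2) : ℂ) + Real.pi / 2 * Complex.I)).congr_deriv ?_
    field_simp
  have h3 : HasDerivAt regularPart
      (-∑ i, ratioDeriv (zExp i) (vExp i) z * moment (kExp i) (uExp i)) z :=
    (HasDerivAt.fun_sum fun i _ => (hasDerivAt_ratio (zExp i) (vExp i) hv).mul_const
      (moment (kExp i) (uExp i) : ℂ)).const_sub _
  refine (((hasDerivAt_ratio 1 4 hv).mul h1).add h3).congr_deriv ?_
  have h4 : ratio 1 4 z = z * ratio 0 4 z := by simp [ratio]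
  rw [stieltjesDeriv, h4]
  field_simp
  ring

/-- In the strip the real part of `z² + 9/4` is at least `(Re z)² + 5/4`, since the poles lie at
height `3/2`; the factor `8` is generous. -/
lemma one_add_sq_le_strip {z : ℂ} (h1 : |z.im| ≤ 1) : 1 + ‖z‖ ^ 2 ≤ 8 * ‖z ^ 2 + 9 / 4‖ := by
  have h2 : (z ^ 2 + 9 / 4).re ≤ ‖z ^ 2 + 9 / 4‖ := Complex.re_le_norm _
  have h3 : (z ^ 2 + 9 / 4).re = z.re ^ 2 - z.im ^ 2 + 9 / 4 := by
    simp [sq]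
  have h4 : z.im ^ 2 ≤ 1 := by
    rw [← sq_abs]
    nlinarith [abs_nonneg z.im]
  rw [Complex.sq_norm, Complex.normSq_apply]
  nlinarith [sq_nonneg z.re]

lemma ne_zero_of_strip {z : ℂ} (h1 : |z.im| ≤ 1) : z ^ 2 + 9 / 4 ≠ 0 := by
  rw [← norm_pos_iff]
  nlinarith [one_add_sq_le_strip h1, sq_nonneg ‖z‖]

lemma abs_log_le_add_inv {n : ℝ} (hn : 0 < n) : |Real.log n| ≤ n + n⁻¹ := by
  have h1 := Real.log_le_self hn.le
  have h2 := Real.log_le_self (inv_pos.2 hn).le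
  rw [Real.log_inv] at h2
  rw [abs_le]
  constructor <;> linarith [inv_pos.2 hn]

/-- Near the threshold a power `-1/2` is integrable, unlike the `n⁻¹` of `abs_log_le_add_inv`, which
is usable only where a factor `z` compensates it. -/
lemma abs_log_le_add_rpow {n : ℝ} (hn : 0 < n) : |Real.log n| ≤ n + 2 * n ^ (-(1 / 2) : ℝ) := by
  have h1 := Real.log_le_self hn.le
  have h2 := Real.log_le_rpow_div (inv_pos.2 hn).le (one_half_pos (α := ℝ))
  rw [Real.log_inv, Real.inv_rpow hn.le, ← Real.rpow_neg hn.le] at h2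
  have h3 : 0 < n ^ (-(1 / 2) : ℝ) := Real.rpow_pos_of_pos hn _
  rw [abs_le]
  constructor <;> linarith

lemma norm_logFactor_le (z : ℂ) :
    ‖logFactor z‖ ≤ |Real.log (3 / 2)| + Real.pi / 2 + Real.pi + |Real.log ‖z‖| := by
  have h1 : ‖Complex.log (-Complex.I * z)‖ ≤ |Real.log ‖z‖| + Real.pi := by
    refine (Complex.norm_le_abs_re_add_abs_im _).trans ?_
    rw [Complex.log_re, Complex.log_im, norm_mul, norm_neg, Complex.norm_I, one_mul]
    gcongr
    exact Complex.abs_arg_le_pi _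
  calc ‖logFactor z‖ ≤ ‖(Real.log (3 / 2) : ℂ)‖ + ‖(Real.pi / 2 * Complex.I : ℂ)‖ +
        ‖Complex.log (-Complex.I * z)‖ := (norm_sub_le _ _).trans (by gcongr; exact norm_add_le _ _)
    _ ≤ |Real.log (3 / 2)| + Real.pi / 2 + (|Real.log ‖z‖| + Real.pi) := by
        gcongr
        · exact (Complex.norm_real _).le
        · rw [norm_mul, Complex.norm_I, mul_one, norm_div, Complex.norm_real,
            Real.norm_of_nonneg Real.pi_pos.le]
          norm_num
    _ = _ := by ring

lemma norm_ratio_succ (p q : ℕ) (z : ℂ) : ‖ratio p q z‖ * ‖z‖ = ‖ratio (p + 1) q z‖ := by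
  rw [← norm_mul, ratio, ratio]
  congr 1
  ring

lemma norm_ratioDeriv_le {z : ℂ} (hz : 1 + ‖z‖ ^ 2 ≤ 8 * ‖z ^ 2 + 9 / 4‖) {p q : ℕ}
    (hpq : p ≤ 2 * q) : ‖ratioDeriv p q z‖ ≤ p * 8 ^ q + 2 * q * 8 ^ (q + 1) := by
  refine (norm_sub_le _ _).trans ?_
  simp only [norm_mul, Complex.norm_natCast, Complex.norm_ofNat]
  gcongr
  · exact norm_ratio_le hz (by omega)
  · exact norm_ratio_le hz (by omega)

/-- The Stieltjes transform is bounded near the real axis, and its derivative has at most a weak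
singularity at the threshold. -/
lemma exists_bound_strip : ∃ M : ℝ, 0 < M ∧ ∀ z : ℂ, |z.im| ≤ 1 → z ≠ 0 →
    ‖stieltjesCont z‖ ≤ M ∧
      (z.re ≠ 0 → ‖stieltjesDeriv z‖ ≤ M * (1 + |z.re| ^ (-(1 / 2) : ℝ))) := by
  set c := |Real.log (3 / 2)| + Real.pi / 2 + Real.pi with hc
  have hc0 : 0 < c := by positivity
  set q := |moment 0 4| + ∑ i, 8 ^ (vExp i) * |moment (kExp i) (uExp i)| with hq
  set q' := ∑ i, (zExp i * 8 ^ vExp i + 2 * vExp i * 8 ^ (vExp i + 1) : ℝ) *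
    |moment (kExp i) (uExp i)| with hq'
  have hq0 : 0 ≤ q := by positivity
  have hq0' : 0 ≤ q' := by positivity
  set N : ℝ := 8 ^ 4 + 2 * 4 * 8 ^ 5 with hN
  refine ⟨8 ^ 4 * c + 2 * 8 ^ 4 + q + (N * c + 2 * N + 8 ^ 4 + q'), by positivity,
    fun z h1 h2 => ?_⟩
  have hv := one_add_sq_le_strip h1
  have hn : 0 < ‖z‖ := norm_pos_iff.2 h2
  have hl := norm_logFactor_le z
  constructor
  · have e1 : ‖regularPart z‖ ≤ q := by
      refine (norm_sub_le _ _).trans (add_le_add (Complex.norm_real _).le ?_)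
      refine (norm_sum_le _ _).trans (Finset.sum_le_sum fun i _ => ?_)
      rw [norm_mul, Complex.norm_real, Real.norm_eq_abs]
      gcongr
      exact norm_ratio_le hv (zExp_le i)
    -- The factor `z` of `ratio 1 4 z` absorbs the `‖z‖⁻¹` in the bound for the logarithm. The
    -- derivative has no such factor, hence the weak singularity in the second half.
    have e2 : ‖ratio 1 4 z‖ * ‖logFactor z‖ ≤ 8 ^ 4 * c + 2 * 8 ^ 4 := by
      calc ‖ratio 1 4 z‖ * ‖logFactor z‖ ≤ ‖ratio 1 4 z‖ * (c + (‖z‖ + ‖z‖⁻¹)) := by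
            gcongr
            exact hl.trans (by gcongr; exact abs_log_le_add_inv hn)
        _ = ‖ratio 1 4 z‖ * c + ‖ratio 2 4 z‖ + ‖ratio 0 4 z‖ := by
            rw [← norm_ratio_succ 1, ← norm_ratio_succ 0]
            field_simp
            ring
        _ ≤ 8 ^ 4 * c + 8 ^ 4 + 8 ^ 4 := by
            gcongr
            · exact norm_ratio_le hv (by norm_num)
            · exact norm_ratio_le hv (by norm_num)
            · exact norm_ratio_le hv (by norm_num)
        _ = _ := by ring
    rw [stieltjesCont_eq]
    refine (norm_add_le _ _).trans ?_
    rw [norm_mul]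
    have : 0 ≤ N * c + 2 * N + 8 ^ 4 + q' := by positivity
    linarith
  · intro h3
    have hre : 0 < |z.re| := abs_pos.2 h3
    set s := |z.re| ^ (-(1 / 2) : ℝ) with hs
    have hs0 : 0 < s := Real.rpow_pos_of_pos hre _
    have hs1 : ‖z‖ ^ (-(1 / 2) : ℝ) ≤ s :=
      Real.rpow_le_rpow_of_nonpos hre (Complex.abs_re_le_norm z) (by norm_num)
    have e1 : ‖∑ i, ratioDeriv (zExp i) (vExp i) z * moment (kExp i) (uExp i)‖ ≤ q' := by
      refine (norm_sum_le _ _).trans (Finset.sum_le_sum fun i _ => ?_)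
      rw [norm_mul, Complex.norm_real, Real.norm_eq_abs]
      gcongr
      exact norm_ratioDeriv_le hv (zExp_le i)
    have e3 : ‖ratioDeriv 1 4 z‖ ≤ N := by
      simpa [hN] using norm_ratioDeriv_le hv (p := 1) (q := 4) (by norm_num)
    -- This controls the growth of the logarithm at infinity, which is bounded by `‖z‖`.
    have e4 : ‖ratioDeriv 1 4 z‖ * ‖z‖ ≤ N := by
      have : ‖ratioDeriv 1 4 z‖ ≤ ‖ratio 0 4 z‖ + 2 * 4 * ‖ratio 2 5 z‖ := by
        refine (norm_sub_le _ _).trans ?_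
        simp
      calc ‖ratioDeriv 1 4 z‖ * ‖z‖ ≤ (‖ratio 0 4 z‖ + 2 * 4 * ‖ratio 2 5 z‖) * ‖z‖ := by gcongr
        _ = ‖ratio 1 4 z‖ + 2 * 4 * ‖ratio 3 5 z‖ := by
            rw [add_mul, mul_assoc, norm_ratio_succ, norm_ratio_succ]
        _ ≤ 8 ^ 4 + 2 * 4 * 8 ^ 5 := by
            gcongr
            · exact norm_ratio_le hv (by norm_num)
            · exact norm_ratio_le hv (by norm_num)
    have e2 : ‖ratioDeriv 1 4 z‖ * ‖logFactor z‖ ≤ N * c + N + 2 * N * s := by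
      calc ‖ratioDeriv 1 4 z‖ * ‖logFactor z‖
          ≤ ‖ratioDeriv 1 4 z‖ * (c + (‖z‖ + 2 * s)) := by
            gcongr
            refine hl.trans ?_
            gcongr
            exact (abs_log_le_add_rpow hn).trans (by gcongr)
        _ = ‖ratioDeriv 1 4 z‖ * c + ‖ratioDeriv 1 4 z‖ * ‖z‖ +
            2 * ‖ratioDeriv 1 4 z‖ * s := by ring
        _ ≤ N * c + N + 2 * N * s := by gcongr
    have e5 : ‖ratio 0 4 z‖ ≤ 8 ^ 4 := norm_ratio_le hv (by norm_num)
    have e6 : ‖stieltjesDeriv z‖ ≤ N * c + N + 2 * N * s + 8 ^ 4 + q' := by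
      rw [stieltjesDeriv]
      refine (norm_sub_le _ _).trans (add_le_add ((norm_sub_le _ _).trans ?_) e1)
      rw [norm_mul]
      gcongr
    refine e6.trans ?_
    have hN0 : 0 < N := by positivity
    have : 0 ≤ (8 ^ 4 * c + 2 * 8 ^ 4 + q + (N * c + 8 ^ 4 + q')) * s := by positivity
    have : 0 ≤ 8 ^ 4 * c + 2 * 8 ^ 4 + q := by positivity
    nlinarith

/-- The weight that dominates the derivative of the resolvent on lines parallel to the real axis. -/
def weight (x : ℝ) : ℝ := (1 + |x| ^ (-(1 / 2) : ℝ)) * (1 + x ^ 2)⁻¹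

lemma weight_nonneg (x : ℝ) : 0 ≤ weight x := by
  have : 0 ≤ |x| ^ (-(1 / 2) : ℝ) := Real.rpow_nonneg (abs_nonneg x) _
  unfold weight
  positivity

lemma integrable_weight : Integrable weight := by
  have h1 : IntegrableOn (fun x : ℝ => |x| ^ (-(1 / 2) : ℝ)) (Icc (-1) 1) := by
    have hp : IntegrableOn (fun x : ℝ => |x| ^ (-(1 / 2) : ℝ)) (Ioc 0 1) := by
      have := (intervalIntegral.intervalIntegrable_rpow' (a := 0) (b := 1)
        (by norm_num : (-1 : ℝ) < -(1 / 2))).1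
      refine this.congr_fun (fun x hx => ?_) measurableSet_Ioc
      simp only [abs_of_pos hx.1]
    have hn : IntegrableOn (fun x : ℝ => |x| ^ (-(1 / 2) : ℝ)) (Ico (-1) 0) := by
      have h2 := (Measure.measurePreserving_neg (volume : Measure ℝ)).integrableOn_comp_preimage
        (Homeomorph.neg ℝ).measurableEmbedding (f := fun x : ℝ => |x| ^ (-(1 / 2) : ℝ))
        (s := Ioc 0 1)
      have h3 := h2.2 hp
      simpa [Function.comp_def] using h3
    have h4 := (hn.union (integrableOn_singleton (x := (0 : ℝ)) (hx := by simp) (by simp))).union hp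
    refine h4.mono_set fun x hx => ?_
    rcases lt_trichotomy x 0 with h | h | h
    · exact Or.inl (Or.inl ⟨hx.1, h⟩)
    · exact Or.inl (Or.inr h)
    · exact Or.inr ⟨h, hx.2⟩
  have hm : Measurable weight := by
    unfold weight
    fun_prop
  refine Integrable.mono' ((integrable_inv_one_add_sq.const_mul 2).add
    (h1.integrable_indicator measurableSet_Icc)) hm.aestronglyMeasurable (ae_of_all _ fun x => ?_)
  rw [Real.norm_of_nonneg (weight_nonneg x), weight]
  have hs : 0 ≤ |x| ^ (-(1 / 2) : ℝ) := Real.rpow_nonneg (abs_nonneg x) _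
  have hi : (1 + x ^ 2)⁻¹ ≤ 1 := inv_le_one_of_one_le₀ (by nlinarith [sq_nonneg x])
  have hi0 : 0 < (1 + x ^ 2)⁻¹ := by positivity
  simp only [Pi.add_apply]
  by_cases hx : x ∈ Icc (-1 : ℝ) 1
  · rw [indicator_of_mem hx]
    nlinarith
  · rw [indicator_of_notMem hx]
    have hx1 : 1 ≤ |x| := by
      by_contra h
      exact hx (abs_le.1 (not_le.1 h).le)
    have := Real.rpow_le_one_of_one_le_of_nonpos hx1 (by norm_num : (-(1 / 2) : ℝ) ≤ 0)
    nlinarith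

/-! ### The resonance -/

/-- The equation `x = c - ε f x` has exactly one solution in a ball on which `ε f` is small and
has a small Lipschitz constant. -/
lemma exists_unique_fixed {E : Type*} [NormedAddCommGroup E] [NormedSpace ℝ E] [CompleteSpace E]
    {c : E} {r M L ε : ℝ} (hr : 0 ≤ r) (hε : 0 ≤ ε) {f : E → E}
    (hM : ∀ x ∈ Metric.closedBall c r, ‖f x‖ ≤ M)
    (hL : ∀ x ∈ Metric.closedBall c r, ∀ y ∈ Metric.closedBall c r, ‖f x - f y‖ ≤ L * ‖x - y‖)
    (h1 : ε * M ≤ r) (h2 : ε * L ≤ 1 / 2) :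
    ∃ p ∈ Metric.closedBall c r, p = c - ε • f p ∧ ‖p - c‖ ≤ ε * M ∧
      ∀ x ∈ Metric.closedBall c r, x = c - ε • f x → x = p := by
  set T : E → E := fun x => c - ε • f x with hT
  have hlip : ∀ x ∈ Metric.closedBall c r, ∀ y ∈ Metric.closedBall c r,
      ‖T x - T y‖ ≤ 1 / 2 * ‖x - y‖ := fun x hx y hy => by
    calc ‖T x - T y‖ = ε * ‖f x - f y‖ := by
          rw [show T x - T y = -(ε • (f x - f y)) by simp only [hT, smul_sub]; abel, norm_neg,
            norm_smul, Real.norm_of_nonneg hε]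
      _ ≤ ε * (L * ‖x - y‖) := by gcongr; exact hL x hx y hy
      _ = ε * L * ‖x - y‖ := by ring
      _ ≤ 1 / 2 * ‖x - y‖ := by gcongr
  have hTM : ∀ x ∈ Metric.closedBall c r, ‖T x - c‖ ≤ ε * M := fun x hx => by
    rw [show T x - c = -(ε • f x) by simp only [hT]; abel, norm_neg, norm_smul,
      Real.norm_of_nonneg hε]
    gcongr
    exact hM x hx
  have hmaps : MapsTo T (Metric.closedBall c r) (Metric.closedBall c r) := fun x hx => by
    rw [mem_closedBall_iff_norm]
    exact (hTM x hx).trans h1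
  have hcontr : ContractingWith (1 / 2) (hmaps.restrict T _ _) := by
    refine ⟨by rw [← NNReal.coe_lt_coe]; norm_num, LipschitzWith.of_dist_le_mul fun x y => ?_⟩
    rw [Subtype.dist_eq, Subtype.dist_eq, dist_eq_norm, dist_eq_norm]
    exact_mod_cast hlip x x.2 y y.2
  obtain ⟨p, hp, hfix, -⟩ := hcontr.exists_fixedPoint' Metric.isClosed_closedBall.isComplete hmaps
    (Metric.mem_closedBall_self hr) (edist_ne_top _ _)
  refine ⟨p, hp, hfix.symm, ?_, fun x hx hfx => ?_⟩
  · have := hTM p hp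
    rwa [hfix] at this
  · have h3 := hlip x hx p hp
    have e : T x = x := hfx.symm
    rw [e, hfix] at h3
    have h4 : ‖x - p‖ = 0 := by linarith [norm_nonneg (x - p)]
    exact sub_eq_zero.1 (norm_eq_zero.1 h4)

/-- The error of the linear approximation and of the trapezoidal rule for a thrice differentiable
function of a complex variable. -/
lemma norm_trapezoid_le {W W₁ W₂ W₃ : ℂ → ℂ} {B : Set ℂ} (hB : Convex ℝ B)
    (h1 : ∀ w ∈ B, HasDerivAt W (W₁ w) w) (h2 : ∀ w ∈ B, HasDerivAt W₁ (W₂ w) w)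
    (h3 : ∀ w ∈ B, HasDerivAt W₂ (W₃ w) w) {M₂ M₃ : ℝ} (hM₂ : ∀ w ∈ B, ‖W₂ w‖ ≤ M₂)
    (hM₃ : ∀ w ∈ B, ‖W₃ w‖ ≤ M₃) {p z : ℂ} (hp : p ∈ B) (hz : z ∈ B) (hne : z ≠ p) :
    ‖W₁ z - (W z - W p) / (z - p)‖ ≤ M₂ * ‖z - p‖ ∧
      ‖W₁ z + W₁ p - 2 * ((W z - W p) / (z - p))‖ ≤ M₃ * ‖z - p‖ ^ 2 := by
  have hd : z - p ≠ 0 := sub_ne_zero.2 hne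
  have hd0 : 0 < ‖z - p‖ := norm_pos_iff.2 hd
  have hM₂0 : 0 ≤ M₂ := (norm_nonneg _).trans (hM₂ p hp)
  have hM₃0 : 0 ≤ M₃ := (norm_nonneg _).trans (hM₃ p hp)
  -- The mean value inequality is applied on the segment and not on `B`, so that all distances are
  -- at most `‖z - p‖`.
  have hs : segment ℝ p z ⊆ B := hB.segment_subset hp hz
  have hsc : Convex ℝ (segment ℝ p z) := convex_segment p z
  have hps : p ∈ segment ℝ p z := left_mem_segment ℝ p z
  have hzs : z ∈ segment ℝ p z := right_mem_segment ℝ p z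
  have hdist : ∀ w ∈ segment ℝ p z, ‖w - p‖ ≤ ‖z - p‖ := fun w hw =>
    norm_sub_le_of_mem_segment hw
  have hdist' : ∀ w ∈ segment ℝ p z, ‖z - w‖ ≤ ‖z - p‖ := fun w hw => by
    rw [norm_sub_rev z w, norm_sub_rev z p]
    exact norm_sub_le_of_mem_segment (segment_symm ℝ p z ▸ hw)
  constructor
  · have hlip : ∀ w ∈ segment ℝ p z, ‖W₁ w - W₁ z‖ ≤ M₂ * ‖z - p‖ := fun w hw => by
      have := Convex.norm_image_sub_le_of_norm_hasDerivWithin_le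
        (fun u hu => (h2 u (hs hu)).hasDerivWithinAt) (fun u hu => hM₂ u (hs hu)) hsc hw hzs
      rw [norm_sub_rev] at this
      exact this.trans (by gcongr; exact hdist' w hw)
    have h4 := Convex.norm_image_sub_le_of_norm_hasDerivWithin_le (f := fun w => W w - w * W₁ z)
      (f' := fun w => W₁ w - W₁ z) (s := segment ℝ p z)
      (fun u hu => by
        have := ((h1 u (hs hu)).sub ((hasDerivAt_id u).mul_const (W₁ z)))
        rw [one_mul] at this
        exact this.hasDerivWithinAt) hlip hsc hps hzs
    have e : W₁ z - (W z - W p) / (z - p) =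
        -((W z - z * W₁ z) - (W p - p * W₁ z)) / (z - p) := by
      field_simp
      ring
    rw [e, norm_div, norm_neg, div_le_iff₀ hd0]
    exact h4
  · have hf2 : ∀ w ∈ segment ℝ p z, ‖(w - p) * W₃ w‖ ≤ M₃ * ‖z - p‖ := fun w hw => by
      rw [norm_mul, mul_comm]
      gcongr
      · exact hM₃ w (hs hw)
      · exact hdist w hw
    have hf1 : ∀ w ∈ segment ℝ p z, ‖W₁ p - W₁ w + (w - p) * W₂ w‖ ≤ M₃ * ‖z - p‖ ^ 2 :=
      fun w hw => by
      have h4 := Convex.norm_image_sub_le_of_norm_hasDerivWithin_le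
        (f := fun w => W₁ p - W₁ w + (w - p) * W₂ w)
        (f' := fun w => (w - p) * W₃ w) (s := segment ℝ p z)
        (fun u hu => by
          have h5 := ((h2 u (hs hu)).const_sub (W₁ p)).add
            (((hasDerivAt_id u).sub_const p).mul (h3 u (hs hu)))
          refine (h5.congr_deriv ?_).hasDerivWithinAt
          simp) hf2 hsc hps hw
      simp only [sub_self, zero_mul, add_zero, sub_zero] at h4
      calc _ ≤ M₃ * ‖z - p‖ * ‖w - p‖ := h4
        _ ≤ M₃ * ‖z - p‖ * ‖z - p‖ := by gcongr; exact hdist w hw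
        _ = _ := by ring
    -- The function vanishes at `p`, and so does its derivative, whose own derivative is `(w - p)
    -- W₃`. Two applications of the mean value inequality give the order `‖z - p‖³`, and division by
    -- `z - p` leaves the square.
    have h4 := Convex.norm_image_sub_le_of_norm_hasDerivWithin_le
      (f := fun w => (w - p) * (W₁ w + W₁ p) - 2 * (W w - W p))
      (f' := fun w => W₁ p - W₁ w + (w - p) * W₂ w) (s := segment ℝ p z)
      (fun u hu => by
        have h5 := (((hasDerivAt_id u).sub_const p).mul ((h2 u (hs hu)).add_const (W₁ p))).sub
          (((h1 u (hs hu)).sub_const (W p)).const_mul 2)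
        refine (h5.congr_deriv ?_).hasDerivWithinAt
        simp only [id]
        ring) hf1 hsc hps hzs
    simp only [sub_self, zero_mul, mul_zero, sub_zero] at h4
    have e : W₁ z + W₁ p - 2 * ((W z - W p) / (z - p)) =
        ((z - p) * (W₁ z + W₁ p) - 2 * (W z - W p)) / (z - p) := by
      field_simp
    rw [e, norm_div, div_le_iff₀ hd0]
    exact h4

/-- The derivative of the resolvent amplitude with the pole subtracted, near the pole. -/
lemma norm_subtracted_le_near {D p h w₁ wp : ℂ} {z : ℂ} {ε M₁ M₂ M₃ : ℝ} (hε : 0 ≤ ε) (hε1 : ε ≤ 1)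
    (hne : z ≠ p) (hD : D = (p - z) * (1 + ε * h)) (hh : ‖h‖ ≤ M₁) (hw : ‖w₁‖ ≤ M₁)
    (hwp : ‖wp‖ ≤ M₁) (hεM : ε * M₁ ≤ 1 / 2) (h2 : ‖w₁ - h‖ ≤ M₂ * ‖z - p‖)
    (h3 : ‖w₁ + wp - 2 * h‖ ≤ M₃ * ‖z - p‖ ^ 2) :
    D ≠ 0 ∧ ‖(1 + ε * w₁) / D ^ 2 - (1 + ε * wp)⁻¹ / (p - z) ^ 2‖ ≤
      ε * (8 * (M₃ + (M₃ * M₁ + M₂ ^ 2))) := by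
  have hM₁ : 0 ≤ M₁ := (norm_nonneg _).trans hh
  have hd : p - z ≠ 0 := sub_ne_zero.2 hne.symm
  have hd0 : 0 < ‖z - p‖ := norm_pos_iff.2 (sub_ne_zero.2 hne)
  have hM₃ : 0 ≤ M₃ := by
    by_contra hcon
    have : M₃ * ‖z - p‖ ^ 2 < 0 := mul_neg_of_neg_of_pos (not_le.1 hcon) (by positivity)
    linarith [norm_nonneg (w₁ + wp - 2 * h)]
  have hlow : ∀ y : ℂ, ‖y‖ ≤ M₁ → 1 / 2 ≤ ‖1 + ε * y‖ := fun y hy => by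
    have h4 : ‖(ε : ℂ) * y‖ ≤ 1 / 2 := by
      rw [norm_mul, Complex.norm_real, Real.norm_of_nonneg hε]
      exact (by gcongr : ε * ‖y‖ ≤ ε * M₁).trans hεM
    have h5 := norm_sub_le (1 + (ε : ℂ) * y) (ε * y)
    rw [add_sub_cancel_right, norm_one] at h5
    linarith
  have hne0 : ∀ y : ℂ, ‖y‖ ≤ M₁ → 1 + ε * y ≠ 0 := fun y hy h0 => by
    have := hlow y hy
    rw [h0, norm_zero] at this
    linarith
  have hh0 := hne0 h hh
  have hp0 := hne0 wp hwp
  refine ⟨by rw [hD]; exact mul_ne_zero hd hh0, ?_⟩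
  -- The numerator is `(1 + ε w₁)(1 + ε wp) - (1 + ε h)²`. Writing `w₁ wp - h²` as `(w₁ + wp - 2h)
  -- w₁ - (w₁ - h)²` expresses it by the two quantities that are small near `p`, each term being of
  -- order `‖z - p‖²`.
  have e : (1 + ε * w₁) / D ^ 2 - (1 + ε * wp)⁻¹ / (p - z) ^ 2 =
      ε * ((w₁ + wp - 2 * h) + ε * ((w₁ + wp - 2 * h) * w₁ - (w₁ - h) ^ 2)) /
        ((z - p) ^ 2 * (1 + ε * h) ^ 2 * (1 + ε * wp)) := by
    have hd' : z - p ≠ 0 := sub_ne_zero.2 hne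
    rw [hD, mul_pow, show (p - z) ^ 2 = (z - p) ^ 2 by ring]
    field_simp
    ring
  rw [e, norm_div, norm_mul, norm_mul, norm_mul, norm_pow, norm_pow, Complex.norm_real,
    Real.norm_of_nonneg hε]
  have hden : ‖z - p‖ ^ 2 * (1 / 8) ≤ ‖z - p‖ ^ 2 * ‖1 + ε * h‖ ^ 2 * ‖1 + ε * wp‖ := by
    rw [mul_assoc]
    gcongr
    calc (1 / 8 : ℝ) = (1 / 2) ^ 2 * (1 / 2) := by norm_num
      _ ≤ ‖1 + ε * h‖ ^ 2 * ‖1 + ε * wp‖ := by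
          gcongr
          · exact hlow h hh
          · exact hlow wp hwp
  have hnum : ‖(w₁ + wp - 2 * h) + ε * ((w₁ + wp - 2 * h) * w₁ - (w₁ - h) ^ 2)‖ ≤
      (M₃ + (M₃ * M₁ + M₂ ^ 2)) * ‖z - p‖ ^ 2 := by
    calc ‖(w₁ + wp - 2 * h) + ε * ((w₁ + wp - 2 * h) * w₁ - (w₁ - h) ^ 2)‖
        ≤ ‖w₁ + wp - 2 * h‖ + ε * (‖w₁ + wp - 2 * h‖ * ‖w₁‖ + ‖w₁ - h‖ ^ 2) := by
          refine (norm_add_le _ _).trans ?_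
          rw [norm_mul, Complex.norm_real, Real.norm_of_nonneg hε]
          gcongr
          refine (norm_sub_le _ _).trans ?_
          rw [norm_mul, norm_pow]
      _ ≤ M₃ * ‖z - p‖ ^ 2 + 1 * (M₃ * ‖z - p‖ ^ 2 * M₁ + (M₂ * ‖z - p‖) ^ 2) := by gcongr
      _ = _ := by ring
  rw [div_le_iff₀ (by linarith [mul_pos (pow_pos hd0 2) (by norm_num : (0 : ℝ) < 1 / 8)])]
  calc ε * ‖(w₁ + wp - 2 * h) + ε * ((w₁ + wp - 2 * h) * w₁ - (w₁ - h) ^ 2)‖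
      ≤ ε * ((M₃ + (M₃ * M₁ + M₂ ^ 2)) * ‖z - p‖ ^ 2) := by gcongr
    _ = ε * (8 * (M₃ + (M₃ * M₁ + M₂ ^ 2))) * (‖z - p‖ ^ 2 * (1 / 8)) := by ring
    _ ≤ _ := by gcongr

/-- The derivative of the resolvent amplitude with the pole subtracted, away from the pole. -/
lemma norm_subtracted_le_far {D P w₁ wp δ : ℂ} {ε M M₁ r : ℝ} (hε : 0 ≤ ε) (hr : 0 < r)
    (hδ : r < ‖δ‖) (hD : ‖D - δ‖ ≤ ε * M) (hP : ‖P - δ‖ ≤ ε * M) (hεM : ε * M ≤ r / 2)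
    (hwp : ‖wp‖ ≤ M₁) (hεM₁ : ε * M₁ ≤ 1 / 2) :
    D ≠ 0 ∧ ‖(1 + ε * w₁) / D ^ 2 - (1 + ε * wp)⁻¹ / P ^ 2‖ ≤
      ε * (4 * ‖w₁‖ + 32 * M / r + 8 * M₁) / ‖δ‖ ^ 2 := by
  have hδ0 : 0 < ‖δ‖ := hr.trans hδ
  have hM₁ : 0 ≤ M₁ := (norm_nonneg _).trans hwp
  have hεM0 : 0 ≤ ε * M := (norm_nonneg _).trans hD
  have hlow : ∀ y : ℂ, ‖y - δ‖ ≤ ε * M → ‖δ‖ / 2 ≤ ‖y‖ := fun y hy => by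
    have := norm_sub_le y (y - δ)
    rw [sub_sub_cancel] at this
    linarith
  have hD1 := hlow D hD
  have hP1 := hlow P hP
  have hD0 : D ≠ 0 := norm_pos_iff.1 (by linarith)
  have hP0 : P ≠ 0 := norm_pos_iff.1 (by linarith)
  have hZ : 1 / 2 ≤ ‖1 + ε * wp‖ := by
    have h4 : ‖(ε : ℂ) * wp‖ ≤ 1 / 2 := by
      rw [norm_mul, Complex.norm_real, Real.norm_of_nonneg hε]
      exact (by gcongr : ε * ‖wp‖ ≤ ε * M₁).trans hεM₁
    have h5 := norm_sub_le (1 + (ε : ℂ) * wp) (ε * wp)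
    rw [add_sub_cancel_right, norm_one] at h5
    linarith
  have hZ0 : 1 + ε * wp ≠ 0 := norm_pos_iff.1 (by linarith)
  have hDi : ‖D⁻¹‖ ≤ 2 / ‖δ‖ := by
    rw [norm_inv, inv_le_comm₀ (norm_pos_iff.2 hD0) (by positivity), inv_div]
    exact hD1
  have hPi : ‖P⁻¹‖ ≤ 2 / ‖δ‖ := by
    rw [norm_inv, inv_le_comm₀ (norm_pos_iff.2 hP0) (by positivity), inv_div]
    exact hP1
  have hZi : ‖(1 + ε * wp)⁻¹‖ ≤ 2 := by
    rw [norm_inv, inv_le_comm₀ (norm_pos_iff.2 hZ0) two_pos]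
    linarith
  have hPD : ‖P - D‖ ≤ 2 * (ε * M) := by
    rw [← sub_sub_sub_cancel_right P D δ]
    exact (norm_sub_le _ _).trans (by linarith)
  refine ⟨hD0, ?_⟩
  -- The two terms differ in the numerators and in the denominators. Each piece carries a factor `ε`
  -- or `P - D`, and the latter is of order `ε`.
  have e : (1 + ε * w₁) / D ^ 2 - (1 + ε * wp)⁻¹ / P ^ 2 =
      ε * w₁ * D⁻¹ ^ 2 + (P - D) * (D⁻¹ ^ 2 * P⁻¹ + D⁻¹ * P⁻¹ ^ 2) +
        ε * wp * (1 + ε * wp)⁻¹ * P⁻¹ ^ 2 := by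
    field_simp
    ring
  rw [e]
  calc _ ≤ ‖(ε : ℂ) * w₁ * D⁻¹ ^ 2‖ + ‖(P - D) * (D⁻¹ ^ 2 * P⁻¹ + D⁻¹ * P⁻¹ ^ 2)‖ +
        ‖(ε : ℂ) * wp * (1 + ε * wp)⁻¹ * P⁻¹ ^ 2‖ := norm_add₃_le
    _ ≤ ε * ‖w₁‖ * (2 / ‖δ‖) ^ 2 + 2 * (ε * M) * ((2 / ‖δ‖) ^ 2 * (2 / ‖δ‖) +
        (2 / ‖δ‖) * (2 / ‖δ‖) ^ 2) + ε * M₁ * 2 * (2 / ‖δ‖) ^ 2 := by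
        simp only [norm_mul, norm_pow, Complex.norm_real, Real.norm_of_nonneg hε]
        gcongr
        refine (norm_add_le _ _).trans ?_
        simp only [norm_mul, norm_pow]
        gcongr
    _ = ε * (4 * ‖w₁‖ + 8 * M₁) / ‖δ‖ ^ 2 + 32 * (ε * M) / ‖δ‖ ^ 2 * ‖δ‖⁻¹ := by
        field_simp
        ring
    _ ≤ ε * (4 * ‖w₁‖ + 8 * M₁) / ‖δ‖ ^ 2 + 32 * (ε * M) / ‖δ‖ ^ 2 * r⁻¹ := by
        gcongr
    _ = _ := by
        field_simp
        ring

lemma slitPlane_of_im_pos {z : ℂ} (hz : 0 < z.im) : -Complex.I * z ∈ Complex.slitPlane :=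
  Or.inl (by simpa using hz)

lemma hasDerivAt_stieltjesCont_of_re_pos {z : ℂ} (hz : 0 < z.re) :
    HasDerivAt stieltjesCont (stieltjesDeriv z) z := by
  refine hasDerivAt_stieltjesCont (Or.inr ?_) fun h => ?_
  · simpa using hz.ne'
  · have h1 := congrArg Complex.re h
    have h2 := congrArg Complex.im h
    simp [sq] at h1 h2
    have h3 : z.im = 0 := by
      rw [mul_comm z.im, ← two_mul, ← mul_assoc] at h2
      exact (mul_eq_zero.1 h2).resolve_left (by positivity)
    rw [h3] at h1
    nlinarith

/-- The Stieltjes transform and its first three derivatives are bounded near `E₀`. -/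
lemma exists_bound_ball {E₀ : ℝ} (hE₀ : 0 < E₀) : ∃ (W₂ W₃ : ℂ → ℂ) (M : ℝ), 0 < M ∧
    ∀ w ∈ Metric.closedBall (E₀ : ℂ) (E₀ / 2), 0 < w.re ∧
      HasDerivAt stieltjesDeriv (W₂ w) w ∧ HasDerivAt W₂ (W₃ w) w ∧
      ‖stieltjesCont w‖ ≤ M ∧ ‖stieltjesDeriv w‖ ≤ M ∧ ‖W₂ w‖ ≤ M ∧ ‖W₃ w‖ ≤ M := by
  have hH : IsOpen {z : ℂ | 0 < z.re} := isOpen_lt continuous_const Complex.continuous_re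
  have hsub : Metric.closedBall (E₀ : ℂ) (E₀ / 2) ⊆ {z : ℂ | 0 < z.re} := fun w hw => by
    rw [mem_closedBall_iff_norm] at hw
    have h := (Complex.abs_re_le_norm (w - E₀)).trans hw
    rw [Complex.sub_re, Complex.ofReal_re, abs_le] at h
    simp only [mem_ofPred_eq]
    linarith [h.1]
  have h0 : DifferentiableOn ℂ stieltjesCont {z : ℂ | 0 < z.re} := fun z hz =>
    (hasDerivAt_stieltjesCont_of_re_pos hz).differentiableAt.differentiableWithinAt
  have h1 : DifferentiableOn ℂ stieltjesDeriv {z : ℂ | 0 < z.re} :=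
    (h0.deriv hH).congr fun z hz => (hasDerivAt_stieltjesCont_of_re_pos hz).deriv.symm
  have h2 := h1.deriv hH
  have h3 := h2.deriv hH
  have hK : IsCompact (Metric.closedBall (E₀ : ℂ) (E₀ / 2)) := isCompact_closedBall _ _
  obtain ⟨C₀, hC₀⟩ := hK.exists_bound_of_continuousOn (h0.continuousOn.mono hsub)
  obtain ⟨C₁, hC₁⟩ := hK.exists_bound_of_continuousOn (h1.continuousOn.mono hsub)
  obtain ⟨C₂, hC₂⟩ := hK.exists_bound_of_continuousOn (h2.continuousOn.mono hsub)
  obtain ⟨C₃, hC₃⟩ := hK.exists_bound_of_continuousOn (h3.continuousOn.mono hsub)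
  refine ⟨deriv stieltjesDeriv, deriv (deriv stieltjesDeriv), |C₀| + |C₁| + |C₂| + |C₃| + 1,
    by positivity, fun w hw => ⟨hsub hw, (h1.differentiableAt (hH.mem_nhds (hsub hw))).hasDerivAt,
    (h2.differentiableAt (hH.mem_nhds (hsub hw))).hasDerivAt, ?_, ?_, ?_, ?_⟩⟩
  · linarith [hC₀ w hw, le_abs_self C₀, abs_nonneg C₁, abs_nonneg C₂, abs_nonneg C₃]
  · linarith [hC₁ w hw, abs_nonneg C₀, le_abs_self C₁, abs_nonneg C₂, abs_nonneg C₃]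
  · linarith [hC₂ w hw, abs_nonneg C₀, abs_nonneg C₁, le_abs_self C₂, abs_nonneg C₃]
  · linarith [hC₃ w hw, abs_nonneg C₀, abs_nonneg C₁, abs_nonneg C₂, le_abs_self C₃]

/-- The denominator of the resolvent amplitude. -/
def denom (E₀ ε : ℝ) (z : ℂ) : ℂ := E₀ - z - ε * stieltjesCont z

set_option maxHeartbeats 1000000 in
/-- For weak coupling the continued resolvent amplitude has a pole `p` in the lower half-plane near
`E₀`.  After subtraction of the pole, the derivative of the amplitude is of order `ε = β²`, uniformly
near the real axis. -/
theorem exists_resonance {E₀ : ℝ} (hE₀ : 0 < E₀) : ∃ b M C : ℝ, 0 < b ∧ 0 < M ∧ 0 < C ∧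
    ∀ ε : ℝ, 0 < ε → ε < b → ε * M ≤ 1 / 2 ∧
      (∃ x₀ : ℝ, |x₀ - E₀| < E₀ / 2 ∧ E₀ - x₀ - ε * F x₀ = 0 ∧
        ∀ x : ℝ, |x - E₀| < E₀ / 2 → E₀ - x - ε * F x = 0 → x = x₀) ∧
      ∃ p : ℂ, p.im < 0 ∧ ‖stieltjesDeriv p‖ ≤ M ∧
        ∀ z : ℂ, 0 < z.im → z.im < 1 → denom E₀ ε z ≠ 0 ∧
          (z.re ≠ 0 → ‖(1 + ε * stieltjesDeriv z) / denom E₀ ε z ^ 2 -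
            (1 + ε * stieltjesDeriv p)⁻¹ / (p - z) ^ 2‖ ≤ ε * C * weight z.re) := by
  obtain ⟨W₂, W₃, M', hM', hball⟩ := exists_bound_ball hE₀
  obtain ⟨M'', hM'', hstrip⟩ := exists_bound_strip
  set M := max M' M'' with hM
  have hM0 : 0 < M := lt_max_of_lt_left hM'
  set B := Metric.closedBall (E₀ : ℂ) (E₀ / 2) with hB
  have hBc : Convex ℝ B := convex_closedBall _ _
  have hd1 : ∀ w ∈ B, HasDerivAt stieltjesCont (stieltjesDeriv w) w := fun w hw =>
    hasDerivAt_stieltjesCont_of_re_pos (hball w hw).1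
  have hW0 : ∀ w ∈ B, ‖stieltjesCont w‖ ≤ M := fun w hw =>
    (hball w hw).2.2.2.1.trans (le_max_left _ _)
  have hW1 : ∀ w ∈ B, ‖stieltjesDeriv w‖ ≤ M := fun w hw =>
    (hball w hw).2.2.2.2.1.trans (le_max_left _ _)
  have hW2 : ∀ w ∈ B, ‖W₂ w‖ ≤ M := fun w hw =>
    (hball w hw).2.2.2.2.2.1.trans (le_max_left _ _)
  have hW3 : ∀ w ∈ B, ‖W₃ w‖ ≤ M := fun w hw =>
    (hball w hw).2.2.2.2.2.2.trans (le_max_left _ _)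
  have hlip : ∀ x ∈ B, ∀ y ∈ B, ‖stieltjesCont x - stieltjesCont y‖ ≤ M * ‖x - y‖ :=
    fun x hx y hy => hBc.norm_image_sub_le_of_norm_hasDerivWithin_le
      (fun u hu => (hd1 u hu).hasDerivWithinAt) hW1 hy hx
  have hcast : ∀ x ∈ Metric.closedBall E₀ (E₀ / 2), 0 < x ∧ (x : ℂ) ∈ B := fun x hx => by
    rw [mem_closedBall_iff_norm, Real.norm_eq_abs] at hx
    refine ⟨by linarith [(abs_le.1 hx).1], ?_⟩
    rwa [hB, mem_closedBall_iff_norm, ← Complex.ofReal_sub, Complex.norm_real, Real.norm_eq_abs]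
  have hFM : ∀ x ∈ Metric.closedBall E₀ (E₀ / 2), ‖F x‖ ≤ M := fun x hx => by
    rw [F_eq (hcast x hx).1, Real.norm_eq_abs]
    exact (Complex.abs_re_le_norm _).trans (hW0 _ (hcast x hx).2)
  have hFL : ∀ x ∈ Metric.closedBall E₀ (E₀ / 2), ∀ y ∈ Metric.closedBall E₀ (E₀ / 2),
      ‖F x - F y‖ ≤ M * ‖x - y‖ := fun x hx y hy => by
    rw [F_eq (hcast x hx).1, F_eq (hcast y hy).1, ← Complex.sub_re, Real.norm_eq_abs]
    refine (Complex.abs_re_le_norm _).trans ((hlip _ (hcast x hx).2 _ (hcast y hy).2).trans_eq ?_)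
    rw [← Complex.ofReal_sub, Complex.norm_real]
  have hE₀B : (E₀ : ℂ) ∈ B := Metric.mem_closedBall_self (by positivity)
  have hG := G_pos hE₀
  set r := E₀ / 2 with hr
  have hr0 : 0 < r := by positivity
  -- In the ball `0 < Re z ≤ 3r`, so the factor `1 + (3r)²` inserts the weight into the near bound.
  -- The last factor of `Cf` compares `1 + (Re z)²` with `‖E₀ - z‖²` outside the ball.
  set Cn := 8 * (M + (M * M + M ^ 2)) * (1 + (3 * r) ^ 2) with hCn
  set Cf := (4 * M + 32 * M / r + 8 * M) * (2 + (1 + 2 * E₀ ^ 2) / r ^ 2) with hCf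
  have hCn0 : 0 < Cn := by positivity
  have hCf0 : 0 < Cf := by positivity
  -- The four conditions on `ε` are used in turn to bound `ε²` by `ε`, to keep the fixed points and
  -- the denominators under control, to make `1 + ε S'` invertible and the fixed-point map a
  -- contraction, and to make `Im S(p)` positive.
  refine ⟨min 1 (min (r / (2 * M)) (min (1 / (2 * M)) (Real.pi * G E₀ / (2 * M ^ 2)))), M, Cn + Cf,
    by positivity, hM0, by positivity, fun ε hε hεb => ?_⟩
  have hε1 : ε ≤ 1 := (hεb.trans_le (min_le_left _ _)).le
  have hεr : ε * M ≤ r / 2 := by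
    have := (hεb.trans_le ((min_le_right _ _).trans (min_le_left _ _))).le
    rw [le_div_iff₀ (by positivity)] at this
    linarith
  have hεM : ε * M ≤ 1 / 2 := by
    have := (hεb.trans_le ((min_le_right _ _).trans
      ((min_le_right _ _).trans (min_le_left _ _)))).le
    rw [le_div_iff₀ (by positivity)] at this
    linarith
  have hεG : ε * M ^ 2 < Real.pi * G E₀ := by
    have := hεb.trans_le ((min_le_right _ _).trans
      ((min_le_right _ _).trans (min_le_right _ _)))
    rw [lt_div_iff₀ (by positivity)] at this
    nlinarith [mul_pos hε (pow_pos hM0 2)]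
  refine ⟨hεM, ?_, ?_⟩
  · obtain ⟨x₀, -, hx₀, hx₀', huniq⟩ := exists_unique_fixed (c := E₀) (r := r) (M := M) (L := M)
      (ε := ε) hr0.le hε.le (f := F) hFM hFL (by linarith) hεM
    rw [Real.norm_eq_abs] at hx₀'
    refine ⟨x₀, by linarith, ?_, fun x hx hfx => huniq x ?_ ?_⟩
    · rw [smul_eq_mul] at hx₀
      linarith
    · rw [mem_closedBall_iff_norm, Real.norm_eq_abs]
      exact hx.le
    · rw [smul_eq_mul]
      linarith
  · obtain ⟨p, hpB, hp, hpE, -⟩ := exists_unique_fixed (c := (E₀ : ℂ)) (r := r) (M := M) (L := M)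
      (ε := ε) hr0.le hε.le hW0 hlip (by linarith) hεM
    rw [Complex.real_smul] at hp
    -- The fixed-point equation gives `Im p = -ε Im S(p)`. As `p` is within `ε M` of `E₀`, `Im S(p)`
    -- differs from `π G(E₀)` by at most `ε M²`.
    have him : p.im < 0 := by
      have h1 : |(stieltjesCont p).im - (stieltjesCont E₀).im| ≤ ε * M ^ 2 := by
        rw [← Complex.sub_im]
        refine (Complex.abs_im_le_norm _).trans ((hlip p hpB E₀ hE₀B).trans ?_)
        calc M * ‖p - E₀‖ ≤ M * (ε * M) := by gcongr
          _ = ε * M ^ 2 := by ring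
      have h2 : 0 < (stieltjesCont p).im := by
        rw [stieltjesCont_im hE₀] at h1
        linarith [(abs_le.1 h1).1]
      have h3 : p.im = -(ε * (stieltjesCont p).im) := by
        conv_lhs => rw [hp]
        simp
      rw [h3]
      nlinarith
    refine ⟨p, him, hW1 p hpB, fun z hz0 hz1 => ?_⟩
    have hzim : |z.im| ≤ 1 := by
      rw [abs_of_pos hz0]
      exact hz1.le
    have hzne : z ≠ 0 := by
      rintro rfl
      simp at hz0
    have hx2 : 0 < 1 + z.re ^ 2 := by positivity
    have hs0 : 0 ≤ |z.re| ^ (-(1 / 2) : ℝ) := Real.rpow_nonneg (abs_nonneg _) _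
    have hwt : (1 + z.re ^ 2)⁻¹ ≤ weight z.re := by
      rw [weight]
      exact le_mul_of_one_le_left (by positivity) (by linarith)
    by_cases hzB : z ∈ B
    · have hne : z ≠ p := by
        rintro rfl
        linarith
      have hd : z - p ≠ 0 := sub_ne_zero.2 hne
      have htr := norm_trapezoid_le hBc hd1 (fun w hw => (hball w hw).2.1)
        (fun w hw => (hball w hw).2.2.1) hW2 hW3 hpB hzB hne
      have hh : ‖(stieltjesCont z - stieltjesCont p) / (z - p)‖ ≤ M := by
        rw [norm_div, div_le_iff₀ (norm_pos_iff.2 hd)]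
        exact hlip z hzB p hpB
      have hDe : denom E₀ ε z =
          (p - z) * (1 + ε * ((stieltjesCont z - stieltjesCont p) / (z - p))) := by
        have : (E₀ : ℂ) = p + ε * stieltjesCont p := by linear_combination -hp
        rw [denom, this]
        field_simp
        ring
      obtain ⟨h1, h2⟩ := norm_subtracted_le_near hε.le hε1 hne hDe hh (hW1 z hzB) (hW1 p hpB) hεM
        htr.1 htr.2
      refine ⟨h1, fun _ => h2.trans ?_⟩
      have hzr : z.re ^ 2 ≤ (3 * r) ^ 2 := by
        have h3 := (Complex.abs_re_le_norm (z - E₀)).trans (mem_closedBall_iff_norm.1 hzB)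
        rw [Complex.sub_re, Complex.ofReal_re, abs_le] at h3
        refine pow_le_pow_left₀ (hball z hzB).1.le ?_ 2
        linarith [h3.2]
      have h4 : 1 ≤ (1 + (3 * r) ^ 2) * weight z.re := by
        calc (1 : ℝ) = (1 + z.re ^ 2) * (1 + z.re ^ 2)⁻¹ := (mul_inv_cancel₀ hx2.ne').symm
          _ ≤ (1 + (3 * r) ^ 2) * weight z.re := by gcongr
      calc ε * (8 * (M + (M * M + M ^ 2)))
          ≤ ε * (8 * (M + (M * M + M ^ 2))) * ((1 + (3 * r) ^ 2) * weight z.re) :=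
            le_mul_of_one_le_right (by positivity) h4
        _ = ε * Cn * weight z.re := by rw [hCn]; ring
        _ ≤ ε * (Cn + Cf) * weight z.re := by
            gcongr
            · exact weight_nonneg _
            · linarith
    · have hδ : r < ‖(E₀ : ℂ) - z‖ := by
        rw [norm_sub_rev]
        rw [hB, mem_closedBall_iff_norm] at hzB
        exact not_le.1 hzB
      have hDδ : ‖denom E₀ ε z - (E₀ - z)‖ ≤ ε * M := by
        rw [denom, sub_sub_cancel_left, norm_neg, norm_mul, Complex.norm_real,
          Real.norm_of_nonneg hε.le]
        gcongr
        exact (hstrip z hzim hzne).1.trans (le_max_right _ _)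
      have hPδ : ‖(p - z) - (E₀ - z)‖ ≤ ε * M := by
        rwa [sub_sub_sub_cancel_right]
      obtain ⟨h1, h2⟩ := norm_subtracted_le_far (w₁ := stieltjesDeriv z) hε.le hr0 hδ hDδ hPδ hεr
        (hW1 p hpB) hεM
      refine ⟨h1, fun hre => h2.trans ?_⟩
      have h3 : ‖stieltjesDeriv z‖ ≤ M * (1 + |z.re| ^ (-(1 / 2) : ℝ)) :=
        ((hstrip z hzim hzne).2 hre).trans (by gcongr; exact le_max_right _ _)
      have h4 : 1 + z.re ^ 2 ≤ (2 + (1 + 2 * E₀ ^ 2) / r ^ 2) * ‖(E₀ : ℂ) - z‖ ^ 2 := by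
        have h5 : (E₀ - z.re) ^ 2 ≤ ‖(E₀ : ℂ) - z‖ ^ 2 := by
          rw [← sq_abs]
          have := Complex.abs_re_le_norm ((E₀ : ℂ) - z)
          rw [Complex.sub_re, Complex.ofReal_re] at this
          gcongr
        have h6 : 1 + 2 * E₀ ^ 2 ≤ (1 + 2 * E₀ ^ 2) / r ^ 2 * ‖(E₀ : ℂ) - z‖ ^ 2 := by
          rw [div_mul_eq_mul_div, le_div_iff₀ (by positivity)]
          gcongr
        nlinarith [sq_nonneg (z.re - 2 * E₀)]
      have h7 : (‖(E₀ : ℂ) - z‖ ^ 2)⁻¹ ≤ (2 + (1 + 2 * E₀ ^ 2) / r ^ 2) * (1 + z.re ^ 2)⁻¹ := by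
        rw [inv_le_iff_one_le_mul₀ (by have := hr0.trans hδ; positivity), mul_right_comm,
          ← div_eq_mul_inv, le_div_iff₀ hx2, one_mul]
        exact h4
      rw [div_eq_mul_inv]
      calc ε * (4 * ‖stieltjesDeriv z‖ + 32 * M / r + 8 * M) * (‖(E₀ : ℂ) - z‖ ^ 2)⁻¹
          ≤ ε * ((4 * M + 32 * M / r + 8 * M) * (1 + |z.re| ^ (-(1 / 2) : ℝ))) *
              ((2 + (1 + 2 * E₀ ^ 2) / r ^ 2) * (1 + z.re ^ 2)⁻¹) := by
            gcongr
            have : 0 ≤ (32 * M / r + 8 * M) * |z.re| ^ (-(1 / 2) : ℝ) := by positivity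
            nlinarith
        _ = ε * Cf * weight z.re := by
            rw [hCf, weight]
            ring
        _ ≤ ε * (Cn + Cf) * weight z.re := by
            gcongr
            · exact weight_nonneg _
            · linarith

/-! ### Exponential decay up to a remainder of order `β² / t` -/

lemma norm_cexp_mul_ofReal (w : ℂ) (t : ℝ) : ‖Complex.exp (w * t)‖ = Real.exp (w.re * t) := by
  rw [Complex.norm_exp, Complex.re_mul_ofReal]

/-- At fixed `β` this makes both decaying exponentials in `c₁` negligible against `1 / t`. -/
lemma tendsto_mul_cexp {w : ℂ} (hw : w.re < 0) :
    Tendsto (fun t : ℝ => (t : ℂ) * Complex.exp (w * t)) atTop (𝓝 0) := by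
  rw [tendsto_zero_iff_norm_tendsto_zero]
  have h := (Real.tendsto_pow_mul_exp_neg_atTop_nhds_zero 1).comp
    (tendsto_id.const_mul_atTop (neg_pos.2 hw))
  have h2 := h.const_mul (-w.re)⁻¹
  rw [mul_zero] at h2
  refine h2.congr' ?_
  filter_upwards [eventually_gt_atTop 0] with t ht
  have hne : w.re ≠ 0 := hw.ne
  rw [norm_mul, Complex.norm_real, Real.norm_of_nonneg ht.le, norm_cexp_mul_ofReal]
  simp only [Function.comp, id, pow_one, neg_mul, neg_neg]
  field_simp

/-- Subtracting the pole from the resolvent amplitude thus amounts to subtracting a decaying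
exponential from the return amplitude. -/
lemma integral_exp_mul_exp {p z : ℂ} (hp : p.im < 0) (hz : 0 < z.im) :
    ∫ t in Ioi (0 : ℝ), Complex.exp (Complex.I * z * t) * Complex.exp (-(Complex.I * p) * t) =
      -(Complex.I * (p - z)⁻¹) := by
  have hre : (Complex.I * (z - p)).re < 0 := by
    simp
    linarith
  have h := integral_exp_mul_complex_Ioi hre 0
  have hne : p - z ≠ 0 := fun h0 => by
    have := congrArg Complex.im h0
    simp at this
    linarith
  have hne' : z - p ≠ 0 := fun h0 => hne (by rw [← neg_sub, h0, neg_zero])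
  calc _ = ∫ t in Ioi (0 : ℝ), Complex.exp (Complex.I * (z - p) * t) := by
        refine integral_congr_ae (ae_of_all _ fun t => ?_)
        simp only [← Complex.exp_add]
        congr 1
        ring
    _ = _ := by
        rw [h, Complex.ofReal_zero, mul_zero, Complex.exp_zero, ← neg_sub z p, inv_neg, mul_neg,
          neg_neg, neg_div, one_div, mul_inv, Complex.inv_I, neg_mul, neg_neg]


/-- The return amplitude is the contribution `(1 + K) exp (-i p t)` of the resonance `p` up to a
remainder of order `β² / t`, uniformly in `t > 0` and in small `β`; here `1 + K` is the residue of
the resolvent amplitude at `p`. -/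
theorem exists_decay {E₀ : ℝ} (hE₀ : 0 < E₀) : ∃ b M C : ℝ, 0 < b ∧ 0 < M ∧ 0 < C ∧
    ∀ β : ℝ, 0 < β → β < b →
      (∃ x₀ : ℝ, |x₀ - E₀| < E₀ / 2 ∧ E₀ - x₀ - β ^ 2 * F x₀ = 0 ∧
        ∀ x : ℝ, |x - E₀| < E₀ / 2 → E₀ - x - β ^ 2 * F x = 0 → x = x₀) ∧
      ∃ p K : ℂ, p.im < 0 ∧ ‖K‖ ≤ M * β ^ 2 ∧
        ∀ t : ℝ, 0 < t → ‖returnAmplitude E₀ β t - (1 + K) * Complex.exp (-(Complex.I * p) * t)‖ ≤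
          C * β ^ 2 / t := by
  obtain ⟨b, M, C, hb, hM, hC, h⟩ := exists_resonance hE₀
  have hw0 : 0 ≤ ∫ x, weight x := integral_nonneg weight_nonneg
  -- The bound `β < 1` gives `β² < b`. The factor `2` bounds `‖Z‖`, and the summand `1` makes the
  -- last constant positive without a proof that the integral of the weight is positive.
  refine ⟨min b 1, 2 * M, (2 * Real.pi)⁻¹ * (C * ∫ x, weight x) + 1, by positivity, by positivity,
    by positivity, fun β hβ hβb => ?_⟩
  have hβ2 : β ^ 2 < b := by
    have h1 := hβb.trans_le (min_le_left _ _)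
    have h2 := hβb.trans_le (min_le_right _ _)
    nlinarith
  obtain ⟨hεM, hx, p, him, hp, hz⟩ := h (β ^ 2) (by positivity) hβ2
  refine ⟨hx, p, (1 + ((β ^ 2 : ℝ) : ℂ) * stieltjesDeriv p)⁻¹ - 1, him, ?_, fun t ht => ?_⟩
  all_goals
    set ε := β ^ 2 with hε
    set Z := (1 + (ε : ℂ) * stieltjesDeriv p)⁻¹ with hZ
    have hε0 : 0 < ε := by positivity
    have hsmall : ‖(ε : ℂ) * stieltjesDeriv p‖ ≤ ε * M := by
      rw [norm_mul, Complex.norm_real, Real.norm_of_nonneg hε0.le]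
      gcongr
    have hlow : 1 / 2 ≤ ‖1 + (ε : ℂ) * stieltjesDeriv p‖ := by
      have h5 := norm_sub_le (1 + (ε : ℂ) * stieltjesDeriv p) (ε * stieltjesDeriv p)
      rw [add_sub_cancel_right, norm_one] at h5
      linarith
    have hne : 1 + (ε : ℂ) * stieltjesDeriv p ≠ 0 := norm_pos_iff.1 (by linarith)
    have hZ2 : ‖Z‖ ≤ 2 := by
      rw [hZ, norm_inv, inv_le_comm₀ (by linarith) two_pos]
      linarith
  · have e : Z - 1 = -((ε : ℂ) * stieltjesDeriv p * Z) := by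
      rw [hZ]
      field_simp
      ring
    rw [e, norm_neg, norm_mul]
    calc ‖(ε : ℂ) * stieltjesDeriv p‖ * ‖Z‖ ≤ (ε * M) * 2 := by gcongr
      _ = 2 * M * ε := by ring
  · rw [add_sub_cancel]
    have hexp : ∀ t : ℝ, 0 < t → ‖Complex.exp (-(Complex.I * p) * t)‖ ≤ 1 := fun t ht => by
      rw [norm_cexp_mul_ofReal, Real.exp_le_one_iff]
      have : (-(Complex.I * p)).re = p.im := by simp
      rw [this]
      exact mul_nonpos_of_nonpos_of_nonneg him.le ht.le
    have hce : Continuous fun t : ℝ => Complex.exp (-(Complex.I * p) * t) := by fun_prop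
    have hcR := continuous_returnAmplitude E₀ β
    have hf : Continuous fun t => returnAmplitude E₀ β t - Z * Complex.exp (-(Complex.I * p) * t) :=
      hcR.sub (continuous_const.mul hce)
    have hbd : ∀ t : ℝ, 0 < t →
        ‖returnAmplitude E₀ β t - Z * Complex.exp (-(Complex.I * p) * t)‖ ≤ 1 + 2 * 1 :=
      fun t ht => by
      refine (norm_sub_le _ _).trans (add_le_add (norm_returnAmplitude_le E₀ β t) ?_)
      rw [norm_mul]
      gcongr
      exact hexp t ht
    have hst : ∀ z : ℂ, 0 < z.im → z.im < 1 → stieltjes z = stieltjesCont z := fun z h0 h1 =>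
      stieltjes_eq h0 (ne_zero_of_strip (by rw [abs_of_pos h0]; exact h1.le))
    have hden : ∀ z : ℂ, 0 < z.im → z.im < 1 →
        (E₀ : ℂ) - z - β ^ 2 * stieltjes z = denom E₀ ε z := fun z h0 h1 => by
      rw [denom, hst z h0 h1, hε, Complex.ofReal_pow]
    have hpz : ∀ z : ℂ, 0 < z.im → p - z ≠ 0 := fun z h0 h1 => by
      have := congrArg Complex.im h1
      simp at this
      linarith
    have key := mul_norm_le_of_laplace hf hbd
      (L := fun z => -(Complex.I * ((denom E₀ ε z)⁻¹ - Z * (p - z)⁻¹)))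
      (J := fun z => -(Complex.I * ((1 + ε * stieltjesDeriv z) / denom E₀ ε z ^ 2 -
        Z / (p - z) ^ 2)))
      (w := fun x => ε * C * weight x) (integrable_weight.const_mul _) ?_ ?_ ?_ ht
    · rw [integral_const_mul] at key
      rw [le_div_iff₀ ht, mul_comm _ t]
      refine key.trans ?_
      calc (2 * Real.pi)⁻¹ * (ε * C * ∫ x, weight x)
          = (2 * Real.pi)⁻¹ * (C * ∫ x, weight x) * ε := by ring
        _ ≤ ((2 * Real.pi)⁻¹ * (C * ∫ x, weight x) + 1) * ε := by
            gcongr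
            linarith
    · intro z h0 h1
      have h2 := integral_exp_mul_returnAmplitude (E₀ := E₀) (β := β) h0
        (by rw [hden z h0 h1]; exact (hz z h0 h1).1)
      rw [hden z h0 h1] at h2
      have h3 := integral_exp_mul_exp him h0
      have hi1 := integrableOn_exp_mul hcR (fun t _ => norm_returnAmplitude_le E₀ β t) h0
      have hi2 := integrableOn_exp_mul hce hexp h0
      simp only [mul_sub, mul_left_comm _ Z]
      rw [integral_sub hi1 (hi2.const_mul Z), integral_const_mul, h2, h3]
      ring
    · intro z h0 h1
      have h2 := hasDerivAt_stieltjesCont (slitPlane_of_im_pos h0)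
        (ne_zero_of_strip (by rw [abs_of_pos h0]; exact h1.le))
      have h3 : HasDerivAt (denom E₀ ε) (-(1 + ε * stieltjesDeriv z)) z := by
        refine (((hasDerivAt_id z).const_sub (E₀ : ℂ)).sub (h2.const_mul (ε : ℂ))).congr_deriv ?_
        ring
      have h4 : HasDerivAt (fun z => p - z) (-1) z := (hasDerivAt_id z).const_sub p
      have h5 := (((h3.fun_inv (hz z h0 h1).1).sub
        ((h4.fun_inv (hpz z h0)).const_mul Z)).const_mul Complex.I).neg
      refine h5.congr_deriv ?_
      ring
    -- The vertical line through the threshold is excluded; it meets the real axis in a null set.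
    · filter_upwards [Measure.ae_ne volume (0 : ℝ)] with x hx y hy hy1
      have hre : ((x : ℂ) + y * Complex.I).re = x := by simp
      have him' : ((x : ℂ) + y * Complex.I).im = y := by simp
      have h2 := (hz (x + y * Complex.I) (by rwa [him']) (by rwa [him'])).2 (by rwa [hre])
      rw [hre] at h2
      rwa [norm_neg, norm_mul, Complex.norm_I, one_mul]

end

end Friedrichs

/-! ### Assembly: from the exact resonance to `λ₀ - iΓ/2` -/

theorem theorem4p1 (E₀ : ℝ) (hE₀ : 0 < E₀) :
    -- the principal values that define `F` exist
    (∀ x : ℝ, 0 < x →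
      Tendsto (Friedrichs.truncatedIntegral x) (𝓝[>] 0) (𝓝 (Friedrichs.F x))) ∧
    ∃ b r C d c : ℝ, 0 < b ∧ 0 < r ∧ r < E₀ ∧ 0 < C ∧ 0 < d ∧ 0 < c ∧
      ∀ β : ℝ, 0 < β → β < b →
        -- `exp (-i t H)` exists
        Friedrichs.IsUnitaryGroup (Friedrichs.hamiltonian E₀ β)
          (Friedrichs.unitaryGroup (Friedrichs.hamiltonian E₀ β)) ∧
        ∃ lam₀ : ℝ,
          (|lam₀ - E₀| < r ∧ E₀ - lam₀ - β ^ 2 * Friedrichs.F lam₀ = 0 ∧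
            ∀ x : ℝ, |x - E₀| < r → E₀ - x - β ^ 2 * Friedrichs.F x = 0 → x = lam₀) ∧
          ∃ (K : ℂ) (corr c₁ c₂ : ℝ → ℂ),
            ‖K‖ ≤ C * β ^ 2 ∧
            (∀ t : ℝ, 0 ≤ t →
              Friedrichs.returnAmplitude E₀ β t =
                (1 + K) * Complex.exp (-Complex.I * lam₀ * t) *
                  Complex.exp (-(Friedrichs.halfWidth E₀ β : ℂ) * t / 2) +
                corr t) ∧
            (∀ t : ℝ, 0 ≤ t → corr t = c₁ t + c₂ t) ∧
            Tendsto (fun t : ℝ => (t : ℂ) * c₁ t) atTop (𝓝 ((β ^ 2 * d / E₀ : ℝ) : ℂ)) ∧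
            ∀ t : ℝ, 0 < t → ‖c₂ t‖ ≤ c * β ^ 2 / t := by
  refine ⟨fun x hx => ?_, ?_⟩
  · rw [Friedrichs.F_eq hx]
    exact Friedrichs.tendsto_truncatedIntegral hx
  obtain ⟨b, M, C, hb, hM, hC, h⟩ := Friedrichs.exists_decay hE₀
  -- The value `d = 1` is a free choice: it fixes the size of the term `β² / (E₀ t)` that is moved
  -- between `c₁` and `c₂`. The price is the summand `1 / E₀` in `c`.
  refine ⟨b, E₀ / 2, M, 1, C + 1 / E₀, hb, by positivity, by linarith, hM, one_pos, by positivity,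
    fun β hβ hβb => ⟨Friedrichs.isUnitaryGroup_unitaryGroup E₀ β, ?_⟩⟩
  obtain ⟨⟨x₀, hx₀⟩, p, K, him, hK, hdecay⟩ := h β hβ hβb
  set w : ℂ := -Complex.I * x₀ - (Friedrichs.halfWidth E₀ β : ℂ) / 2 with hw
  have hwre : w.re < 0 := by
    have h1 : 0 < Friedrichs.halfWidth E₀ β := by
      have := Friedrichs.G_pos hE₀
      have := Real.pi_pos
      unfold Friedrichs.halfWidth
      positivity
    have h2 : w.re = -(Friedrichs.halfWidth E₀ β / 2) := by
      rw [hw, Complex.sub_re, show (Friedrichs.halfWidth E₀ β : ℂ) / 2 =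
        ((Friedrichs.halfWidth E₀ β / 2 : ℝ) : ℂ) by push_cast; rfl, Complex.ofReal_re]
      simp
    linarith
  have hpre : (-(Complex.I * p)).re < 0 := by simpa using him
  -- `c₁` contains the difference between the exact resonance and `λ₀ - i Γ / 2`, which is not of
  -- order `β² / t` uniformly in `β`; `c₂` contains the remainder of `exists_decay`.
  refine ⟨x₀, hx₀, K,
    fun t => Friedrichs.returnAmplitude E₀ β t - (1 + K) * Complex.exp (w * t),
    fun t => (1 + K) * (Complex.exp (-(Complex.I * p) * t) - Complex.exp (w * t)) +
      ((β ^ 2 / E₀ / t : ℝ) : ℂ),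
    fun t => (Friedrichs.returnAmplitude E₀ β t - (1 + K) * Complex.exp (-(Complex.I * p) * t)) -
      ((β ^ 2 / E₀ / t : ℝ) : ℂ), hK, fun t _ => ?_, fun t _ => ?_, ?_, fun t ht => ?_⟩
  · have e : Complex.exp (w * t) = Complex.exp (-Complex.I * x₀ * t) *
        Complex.exp (-(Friedrichs.halfWidth E₀ β : ℂ) * t / 2) := by
      rw [← Complex.exp_add, hw]
      congr 1
      ring
    change _ = _ + (Friedrichs.returnAmplitude E₀ β t - (1 + K) * Complex.exp (w * t))
    rw [e]
    ring
  · ring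
  · have h1 := ((Friedrichs.tendsto_mul_cexp hpre).sub
      (Friedrichs.tendsto_mul_cexp hwre)).const_mul (1 + K)
    have h2 := h1.add_const ((β ^ 2 * 1 / E₀ : ℝ) : ℂ)
    rw [sub_zero, mul_zero, zero_add] at h2
    refine h2.congr' ?_
    filter_upwards [eventually_gt_atTop 0] with t ht
    have ht' : (t : ℂ) ≠ 0 := Complex.ofReal_ne_zero.2 ht.ne'
    push_cast
    field_simp
  · refine (norm_sub_le _ _).trans ((add_le_add (hdecay t ht) le_rfl).trans_eq ?_)
    rw [Complex.norm_real, Real.norm_of_nonneg (by positivity)]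
    field_simp
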